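/- Let $d \ge 2$ be a fixed integer. For $n$ with $dn$ even, let $G_{n,d}$ be a uniformly random $d$-regular simple graph on the vertex set $\{1,\dots,n\}$, and let $\gamma(G)$ denote the orientable genus of a graph $G$, that is, the smallest $g \ge 0$ such that $G$ can be drawn without edge crossings on the sphere with $g$ handles. Then for every $\varepsilon > 0$, $$\Pr\left[(1-\varepsilon)\,\frac{(d-2)n}{4} \;\le\; \gamma(G_{n,d}) \;\le\; (1+\varepsilon)\,\frac{(d-2)n}{4}\right] \longrightarrow 1$$ as $n \to \infty$ through the integers with $dn$ even. (For $d = 2$ this says that $\gamma(G_{n,2}) = 0$ with probability tending to $1$.) -/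

import Mathlib

open Filter Topology

/-- A cellular decomposition of a closed connected oriented surface, encoded as a combinatorial
oriented map. `Dart` is the set of oriented edges (1-cells with a direction), `rev` reverses the
direction, and `rot` sends a dart to the next one, in the positive sense, among the darts that
leave the same vertex. -/
structure CellSurface where
  Dart : Type
  [fintypeDart : Fintype Dart]
  [decEqDart : DecidableEq Dart]
  [nonemptyDart : Nonempty Dart]
  rot : Equiv.Perm Dart
  rev : Equiv.Perm Dart
  rev_rev : ∀ a, rev (rev a) = a
  rev_ne : ∀ a, rev a ≠ a
  connected : ∀ a b, ∃ τ ∈ Subgroup.closure {rot, rev}, τ a = b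

namespace CellSurface

attribute [instance] fintypeDart decEqDart nonemptyDart

variable (S : CellSurface)

/-- The 0-cells: the cycles of `rot`, fixed points included. -/
def Vertex : Type := Quotient (Equiv.Perm.SameCycle.setoid S.rot)

/-- The 1-cells: the pairs of mutually reverse darts. -/
def Edge : Type := Quotient (Equiv.Perm.SameCycle.setoid S.rev)

/-- The 2-cells: the cycles of the permutation that walks along a dart and then turns to the next
dart at the vertex reached, that is, the boundary walks of the 2-cells. -/
def Face : Type := Quotient (Equiv.Perm.SameCycle.setoid (S.rot * S.rev))

/-- The vertex that a dart leaves. -/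
def source (a : S.Dart) : S.Vertex := Quotient.mk (Equiv.Perm.SameCycle.setoid S.rot) a

/-- The surface is the sphere with `g` handles: its Euler characteristic is `2 - 2g`. -/
def HasGenus (g : ℕ) : Prop :=
  (Nat.card S.Vertex : ℤ) - Nat.card S.Edge + Nat.card S.Face = 2 - 2 * g

end CellSurface

namespace SimpleGraph

/-- A drawing without crossings of a graph on a surface, presented by a cellular decomposition
that contains it: distinct vertices of the graph are distinct 0-cells, distinct edges are distinct
1-cells with the right ends. The decomposition may have further cells, so the faces of the drawing
itself need not be discs and the graph need not be connected. -/
structure Drawing {V : Type*} (G : SimpleGraph V) (S : CellSurface) where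
  vert : V → S.Vertex
  vert_injective : Function.Injective vert
  dart : G.Dart → S.Dart
  dart_injective : Function.Injective dart
  dart_symm : ∀ a : G.Dart, dart a.symm = S.rev (dart a)
  source_dart : ∀ a : G.Dart, S.source (dart a) = vert a.fst

/-- The orientable genus of a graph: the smallest `g` such that the graph can be drawn without
crossings on the sphere with `g` handles. -/
noncomputable def genus {V : Type*} (G : SimpleGraph V) : ℕ :=
  sInf {g : ℕ | ∃ S : CellSurface, S.HasGenus g ∧ Nonempty (G.Drawing S)}

end SimpleGraph

open scoped Classical in
/-- The `d`-regular simple graphs on the vertex set `Fin n`. -/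
def regularGraphs (n d : ℕ) : Set (SimpleGraph (Fin n)) :=
  {G | G.IsRegularOfDegree d}

/-- The probability that a uniformly random `d`-regular graph on `Fin n` has the property `P`. -/
noncomputable def regularGraphProb (n d : ℕ) (P : SimpleGraph (Fin n) → Prop) : ℝ :=
  ({G ∈ regularGraphs n d | P G}.ncard : ℝ) / ((regularGraphs n d).ncard : ℝ)

/-
A surface is a pair of permutations of the darts, a cyclic order around the vertices and the
reversal of edges; its faces are the cycles of their product. Each transposition multiplied into a
permutation merges or splits one pair of cycles, so the Euler characteristic computed from the
three numbers of cycles is at most twice the number of components. For a `d`-regular graph `G` on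
`n` vertices it follows that `4 γ(G)` differs from `(d - 2) n` by at most twice the number of faces
of some rotation of `G`. For the lower bound, the rotation of an optimal surface is induced on the
darts of `G`, which does not increase the genus; for the upper bound, any rotation of `G` is
completed to a connected surface by a hub joined to every component.

A face with fewer than `L` sides follows a closed walk without backtracking, so it contains an edge
of a short cycle of `G`. Hence the number of faces is at most `dn / L` plus the number of oriented
edges on short cycles. That number is bounded on average: exchanging an edge `ab` on a short cycle
and a far edge `xy` for `ax` and `by` leads to a `d`-regular graph in which `a` and `b` are still
close, and only boundedly many pairs `a`, `b` per vertex are close. Markov's inequality concludes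
for `d ≥ 3`. For `d = 2`, reversing a dart always leads to a different face, so every component
has two faces, and Euler's formula leaves genus zero.
-/

open Equiv Equiv.Perm

section Setoids

variable {D : Type*}

/-- The number of classes of an equivalence relation (`0` if there are infinitely many). -/
noncomputable def numClasses (r : Setoid D) : ℕ := Nat.card (Quotient r)

theorem ncard_range_eq_numClasses {Y : Type*} (f : D → Y) :
    (Set.range f).ncard = numClasses (Setoid.ker f) := by
  rw [← Nat.card_coe_set_eq, numClasses, Nat.card_congr (Setoid.quotientKerEquivRange f)]

theorem numClasses_le_of_le [Finite D] {r s : Setoid D} (h : r ≤ s) :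
    numClasses s ≤ numClasses r :=
  Nat.card_le_card_of_surjective (Quotient.map' id h)
    ((Quotient.mk''_surjective (s₁ := s)).of_comp (g := Quotient.mk r))

theorem ncard_range_le_numClasses [Finite D] {Y : Type*} {r : Setoid D} {f : D → Y}
    (h : r ≤ Setoid.ker f) : (Set.range f).ncard ≤ numClasses r :=
  (ncard_range_eq_numClasses f).trans_le (numClasses_le_of_le h)

theorem numClasses_bot : numClasses (⊥ : Setoid D) = Nat.card D :=
  (Nat.card_congr (Equiv.ofBijective (Quotient.mk (⊥ : Setoid D))
    ⟨fun _ _ h => Quotient.exact h, Quotient.mk_surjective⟩)).symm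

theorem numClasses_top [Nonempty D] : numClasses (⊤ : Setoid D) = 1 :=
  Nat.card_eq_one_iff_unique.2
    ⟨⟨fun p q => Quotient.inductionOn₂ p q fun _ _ => Quotient.sound trivial⟩,
      ⟨Quotient.mk ⊤ (Classical.arbitrary D)⟩⟩

open scoped Classical in
/-- The equivalence relation obtained from `r` by uniting the classes of `a` and `b`, as the kernel
of the map that redirects the class of `a` to that of `b`. -/
noncomputable def glueClasses (r : Setoid D) (a b : D) : Setoid D :=
  Setoid.ker fun x =>
    if Quotient.mk r x = Quotient.mk r a then Quotient.mk r b else Quotient.mk r x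

open scoped Classical in
theorem glueClasses_iff {r : Setoid D} {a b x y : D} : glueClasses r a b x y ↔
    (if Quotient.mk r x = Quotient.mk r a then Quotient.mk r b else Quotient.mk r x) =
      if Quotient.mk r y = Quotient.mk r a then Quotient.mk r b else Quotient.mk r y :=
  Iff.rfl

theorem le_glueClasses (r : Setoid D) (a b : D) : r ≤ glueClasses r a b := fun x y h => by
  rw [glueClasses_iff, Quotient.sound h]

theorem glueClasses_rel (r : Setoid D) (a b : D) : glueClasses r a b a b := by
  rw [glueClasses_iff, if_pos rfl, ite_self]

theorem glueClasses_le {r s : Setoid D} {a b : D} (h : r ≤ s) (hab : s a b) :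
    glueClasses r a b ≤ s := by
  intro x y hxy
  rw [glueClasses_iff] at hxy
  split_ifs at hxy with hx hy hy <;> rw [Quotient.eq] at *
  · exact s.trans (h hx) (s.symm (h hy))
  · exact s.trans (h hx) (s.trans hab (h hxy))
  · exact s.trans (h hxy) (s.symm (s.trans (h hy) hab))
  · exact h hxy

theorem glueClasses_eq_self {r : Setoid D} {a b : D} (h : r a b) : glueClasses r a b = r :=
  le_antisymm (glueClasses_le le_rfl h) (le_glueClasses r a b)

theorem sup_glueClasses (r s : Setoid D) (a b : D) :
    r ⊔ glueClasses s a b = glueClasses (r ⊔ s) a b := by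
  refine le_antisymm (sup_le (le_sup_left.trans (le_glueClasses _ a b)) ?_) ?_
  · exact glueClasses_le (le_sup_right.trans (le_glueClasses _ a b)) (glueClasses_rel _ a b)
  · exact glueClasses_le (sup_le_sup_left (le_glueClasses s a b) r)
      ((le_sup_right : _ ≤ r ⊔ glueClasses s a b) (glueClasses_rel s a b))

theorem numClasses_glueClasses [Finite D] {r : Setoid D} {a b : D} (h : ¬ r a b) :
    numClasses (glueClasses r a b) + 1 = numClasses r := by
  classical
  have hba : Quotient.mk r b ≠ Quotient.mk r a := fun hba => h (r.symm (Quotient.exact hba))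
  have hrange : Set.range (fun x =>
      if Quotient.mk r x = Quotient.mk r a then Quotient.mk r b else Quotient.mk r x) =
      {Quotient.mk r a}ᶜ := by
    ext q
    constructor
    · rintro ⟨x, rfl⟩
      dsimp only
      split_ifs with hx
      · exact hba
      · exact hx
    · induction q using Quotient.inductionOn with | _ x => exact fun hx => ⟨x, if_neg hx⟩
  rw [glueClasses, ← ncard_range_eq_numClasses, hrange, ← Set.ncard_singleton (Quotient.mk r a),
    add_comm, Set.ncard_add_ncard_compl, numClasses]

end Setoids

section Cycles

variable {D : Type*}

/-- The number of cycles of a permutation, fixed points included. -/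
noncomputable def numCycles (π : Perm D) : ℕ := numClasses (SameCycle.setoid π)

theorem sameCycle_setoid_le {π : Perm D} {r : Setoid D} (h : ∀ x, r x (π x)) :
    SameCycle.setoid π ≤ r := by
  rintro x _ ⟨i, rfl⟩
  induction i with
  | zero => exact r.refl x
  | succ i ih =>
    rw [add_comm, zpow_one_add]
    exact r.trans ih (h _)
  | pred i ih =>
    have hstep := h ((π ^ (-(i : ℤ) - 1)) x)
    rw [← Perm.mul_apply, ← zpow_one_add, add_sub_cancel] at hstep
    exact r.trans ih (r.symm hstep)

theorem ncard_range_le_numCycles [Finite D] {Y : Type*} {π : Perm D} {f : D → Y}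
    (hf : ∀ x, f (π x) = f x) : (Set.range f).ncard ≤ numCycles π :=
  ncard_range_le_numClasses (sameCycle_setoid_le fun x => (hf x).symm)

theorem sameCycle_setoid_mul_le (π τ : Perm D) :
    SameCycle.setoid (π * τ) ≤ SameCycle.setoid π ⊔ SameCycle.setoid τ :=
  sameCycle_setoid_le fun x => (SameCycle.setoid π ⊔ SameCycle.setoid τ).trans
    ((le_sup_right : SameCycle.setoid τ ≤ _) (sameCycle_apply_right.2 (SameCycle.refl τ x)))
    ((le_sup_left : SameCycle.setoid π ≤ _) (sameCycle_apply_right.2 (SameCycle.refl π (τ x))))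

theorem sameCycle_setoid_one : SameCycle.setoid (1 : Perm D) = ⊥ :=
  le_bot_iff.1 (sameCycle_setoid_le fun _ => rfl)

theorem exists_lt_pow_eq_of_sameCycle [Finite D] {σ : Perm D} {y c : D} {k : ℕ}
    (h : SameCycle σ y c) (hk : 0 < k) (hy : (σ ^ k) y = y) : ∃ j < k, (σ ^ j) y = c := by
  obtain ⟨n, rfl⟩ := h.exists_nat_pow_eq
  have hper : Function.IsPeriodicPt σ k y := by
    rwa [Function.IsPeriodicPt, Function.IsFixedPt, iterate_eq_pow]
  refine ⟨n % k, Nat.mod_lt n hk, ?_⟩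
  rw [← iterate_eq_pow, hper.iterate_mod_apply, iterate_eq_pow]

/-- The point `y` comes back to the set `T` under iteration of `σ` for the first time after `k`
steps. Here `y` itself need not lie in `T`. -/
structure IsFirstReturn (σ : Perm D) (T : Set D) (y : D) (k : ℕ) : Prop where
  pos : 0 < k
  mem : (σ ^ k) y ∈ T
  notMem : ∀ j, 0 < j → j < k → (σ ^ j) y ∉ T

theorem exists_isFirstReturn [Finite D] {σ : Perm D} {T : Set D} {y c : D} (h : SameCycle σ y c)
    (hc : c ∈ T) : ∃ k, IsFirstReturn σ T y k := by
  classical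
  have hex : ∃ k, 0 < k ∧ (σ ^ k) y ∈ T := by
    obtain ⟨k, hk, -, rfl⟩ := h.exists_pow_eq''
    exact ⟨k, hk, hc⟩
  exact ⟨Nat.find hex, (Nat.find_spec hex).1, (Nat.find_spec hex).2,
    fun j hj hlt hmem => Nat.find_min hex hlt ⟨hj, hmem⟩⟩

namespace IsFirstReturn

variable {σ : Perm D} {T : Set D} {k : ℕ}

theorem pow_ne [Finite D] {y c : D} (hk : IsFirstReturn σ T y k) (hc : c ∈ T) (hcy : c ≠ y)
    (h : SameCycle σ y c) : (σ ^ k) y ≠ y := by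
  intro hy
  obtain ⟨j, hj, rfl⟩ := exists_lt_pow_eq_of_sameCycle h hk.pos hy
  exact hk.notMem j (Nat.pos_of_ne_zero fun h0 => hcy (by rw [h0, pow_zero, one_apply])) hj hc

theorem mul_pow_apply {β : Perm D} {x : D} (hβ : ∀ y ∉ T, β y = y)
    (hk : IsFirstReturn σ T (β x) k) {j : ℕ} (hj : 0 < j) (hjk : j ≤ k) :
    ((σ * β) ^ j) x = (σ ^ j) (β x) := by
  induction j, hj using Nat.le_induction with
  | base => simp only [pow_one, Perm.mul_apply]
  | succ j hj ih =>
    rw [pow_succ', Perm.mul_apply, ih (by omega), Perm.mul_apply, hβ _ (hk.notMem j hj hjk),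
      pow_succ', Perm.mul_apply]

theorem mul_right {β : Perm D} {x : D} (hβ : ∀ y ∉ T, β y = y)
    (hk : IsFirstReturn σ T (β x) k) : IsFirstReturn (σ * β) T x k where
  pos := hk.pos
  mem := hk.mul_pow_apply hβ hk.pos le_rfl ▸ hk.mem
  notMem j hj hjk := hk.mul_pow_apply hβ hj hjk.le ▸ hk.notMem j hj hjk

end IsFirstReturn

end Cycles

section Transpositions

variable {D : Type*} [DecidableEq D] {π : Perm D} {a b : D}

theorem swap_apply_of_notMem_pair {y : D} (hy : y ∉ ({a, b} : Set D)) : swap a b y = y :=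
  swap_apply_of_ne_of_ne (fun h => hy (Or.inl h)) (fun h => hy (Or.inr h))

theorem sameCycle_mul_swap [Finite D] (h : ¬ SameCycle π a b) : SameCycle (π * swap a b) a b := by
  obtain ⟨k, hk⟩ := exists_isFirstReturn (T := {a, b}) (SameCycle.refl π (swap a b a))
    (by rw [swap_apply_left]; exact Or.inr rfl)
  have hpow := hk.mul_pow_apply (fun y => swap_apply_of_notMem_pair) hk.pos le_rfl
  have hmem := hk.mem
  rw [swap_apply_left] at hpow hmem
  rcases hmem with ha | hb
  · exact absurd (SameCycle.symm ⟨k, ha⟩) h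
  · exact ⟨k, hpow.trans hb⟩

theorem not_sameCycle_mul_swap [Finite D] (hab : a ≠ b) (h : SameCycle π a b) :
    ¬ SameCycle (π * swap a b) a b := by
  obtain ⟨k, hk⟩ := exists_isFirstReturn (T := {a, b}) (SameCycle.refl π (swap a b a))
    (by rw [swap_apply_left]; exact Or.inr rfl)
  have hpow := hk.mul_pow_apply (fun y => swap_apply_of_notMem_pair) hk.pos le_rfl
  have hret := hk.mul_right fun y => swap_apply_of_notMem_pair
  rw [swap_apply_left] at hpow hk
  have ha : (π ^ k) b = a := hk.mem.resolve_right (hk.pow_ne (Or.inl rfl) hab h.symm)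
  exact fun hs => hret.pow_ne (Or.inr rfl) hab.symm hs (hpow.trans ha)

theorem sameCycle_setoid_mul_swap_le (π : Perm D) (a b : D) :
    SameCycle.setoid (π * swap a b) ≤ glueClasses (SameCycle.setoid π) a b := by
  refine (sameCycle_setoid_mul_le _ _).trans (sup_le (le_glueClasses _ a b) ?_)
  refine sameCycle_setoid_le fun x => ?_
  by_cases hx : x ∈ ({a, b} : Set D)
  · rcases hx with rfl | rfl
    · rw [swap_apply_left]; exact glueClasses_rel _ _ _
    · rw [swap_apply_right]; exact (glueClasses _ a x).symm (glueClasses_rel _ _ _)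
  · rw [swap_apply_of_notMem_pair hx]

theorem glueClasses_setoid_mul_swap (π : Perm D) (a b : D) :
    glueClasses (SameCycle.setoid (π * swap a b)) a b = glueClasses (SameCycle.setoid π) a b := by
  refine le_antisymm (glueClasses_le (sameCycle_setoid_mul_swap_le π a b)
    (glueClasses_rel _ a b)) (glueClasses_le ?_ (glueClasses_rel _ a b))
  simpa only [mul_swap_mul_self] using sameCycle_setoid_mul_swap_le (π * swap a b) a b

theorem sameCycle_setoid_mul_swap [Finite D] (h : ¬ SameCycle π a b) :
    SameCycle.setoid (π * swap a b) = glueClasses (SameCycle.setoid π) a b := by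
  rw [← glueClasses_setoid_mul_swap, glueClasses_eq_self (sameCycle_mul_swap h)]

theorem numCycles_mul_swap_of_not_sameCycle [Finite D] (h : ¬ SameCycle π a b) :
    numCycles (π * swap a b) + 1 = numCycles π := by
  rw [numCycles, sameCycle_setoid_mul_swap h]
  exact numClasses_glueClasses h

theorem numCycles_mul_swap_of_sameCycle [Finite D] (hab : a ≠ b) (h : SameCycle π a b) :
    numCycles (π * swap a b) = numCycles π + 1 := by
  have hsplit := numCycles_mul_swap_of_not_sameCycle (not_sameCycle_mul_swap hab h)
  rw [mul_swap_mul_self] at hsplit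
  exact hsplit.symm

end Transpositions

section CombinatorialMaps

variable {D : Type*}

/-- The orbits of the group generated by `σ` and `α`: the connected components of the map whose
vertices and edges are the cycles of `σ` and of `α`. -/
def jointOrbits (σ α : Perm D) : Setoid D := SameCycle.setoid σ ⊔ SameCycle.setoid α

theorem jointOrbits_apply_left (σ α : Perm D) (x : D) : jointOrbits σ α x (σ x) :=
  (le_sup_left : _ ≤ jointOrbits σ α) (sameCycle_apply_right.2 (SameCycle.refl σ x))

theorem jointOrbits_apply_right (σ α : Perm D) (x : D) : jointOrbits σ α x (α x) :=
  (le_sup_right : _ ≤ jointOrbits σ α) (sameCycle_apply_right.2 (SameCycle.refl α x))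

theorem jointOrbits_le {σ α : Perm D} {r : Setoid D} (hσ : ∀ x, r x (σ x))
    (hα : ∀ x, r x (α x)) : jointOrbits σ α ≤ r :=
  sup_le (sameCycle_setoid_le hσ) (sameCycle_setoid_le hα)

/-- Twice the genus of the oriented map with vertices the cycles of `σ`, edges the cycles of `α`
and faces the cycles of `σ * α`; it is summed over the components of a disconnected map. Fixed
points of `α` are edges with a free end: such an edge and the dart on it cancel, so that edges
can be added one at a time. -/
noncomputable def twiceGenus (σ α : Perm D) : ℤ :=
  Nat.card D + 2 * numClasses (jointOrbits σ α) - numCycles σ - numCycles α - numCycles (σ * α)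

theorem twiceGenus_one (σ : Perm D) : twiceGenus σ 1 = 0 := by
  rw [twiceGenus, jointOrbits, numCycles, numCycles, numCycles, sameCycle_setoid_one, sup_bot_eq,
    mul_one, numClasses_bot]
  ring

theorem not_sameCycle_of_apply_eq_self {α : Perm D} {a b : D} (hab : a ≠ b) (ha : α a = a) :
    ¬ SameCycle α a b := fun h => hab (h.eq_of_left ha)

theorem twiceGenus_mul_swap [Finite D] [DecidableEq D] (σ : Perm D) {α : Perm D} {a b : D}
    (hab : a ≠ b) (ha : α a = a) : twiceGenus σ (α * swap a b) = twiceGenus σ α ∨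
      twiceGenus σ (α * swap a b) = twiceGenus σ α + 2 := by
  have hnot : ¬ SameCycle α a b := not_sameCycle_of_apply_eq_self hab ha
  have hedges := numCycles_mul_swap_of_not_sameCycle hnot
  have hjoint : jointOrbits σ (α * swap a b) = glueClasses (jointOrbits σ α) a b := by
    rw [jointOrbits, sameCycle_setoid_mul_swap hnot, sup_glueClasses, jointOrbits]
  rw [twiceGenus, twiceGenus, hjoint, ← mul_assoc]
  by_cases hcomp : jointOrbits σ α a b
  · rw [glueClasses_eq_self hcomp]
    by_cases hface : SameCycle (σ * α) a b
    · have hfaces := numCycles_mul_swap_of_sameCycle hab hface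
      omega
    · have hfaces := numCycles_mul_swap_of_not_sameCycle hface
      omega
  · have hcomps := numClasses_glueClasses hcomp
    have hfaces := numCycles_mul_swap_of_not_sameCycle
      fun hface => hcomp (sameCycle_setoid_mul_le σ α hface)
    omega

theorem involution_induction [Finite D] [DecidableEq D] {p : Perm D → Prop} (one : p 1)
    (mul_swap : ∀ (γ : Perm D) (a b : D), a ≠ b → γ a = a → γ b = b → p γ → p (γ * swap a b))
    (γ : Perm D) (hγ : Function.Involutive γ) : p γ := by
  have : Fintype D := Fintype.ofFinite D
  induction hn : γ.support.card using Nat.strong_induction_on generalizing γ with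
  | _ n ih =>
  by_cases hone : γ = 1
  · rwa [hone]
  obtain ⟨a, ha⟩ : ∃ a, γ a ≠ a := by
    by_contra! h
    exact hone (Equiv.ext h)
  have hcomm : γ * swap a (γ a) = swap a (γ a) * γ := by
    rw [mul_swap_eq_swap_mul, hγ a, swap_comm]
  have hinv : Function.Involutive (γ * swap a (γ a)) := fun x => by
    nth_rw 1 [hcomm]
    rw [Perm.mul_apply, Perm.mul_apply, hγ, swap_apply_self]
  have hstep := mul_swap (γ * swap a (γ a)) a (γ a) ha.symm
    (by rw [Perm.mul_apply, swap_apply_left, hγ]) (by rw [Perm.mul_apply, swap_apply_right])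
    (ih _ (by rw [← hn, hcomm]; exact card_support_swap_mul ha) _ hinv rfl)
  rwa [mul_swap_mul_self] at hstep

theorem disjoint_of_disjoint_mul_swap [DecidableEq D] {β γ : Perm D} {a b : D} (hab : a ≠ b)
    (ha : γ a = a) (hb : γ b = b) (h : Perm.Disjoint β (γ * swap a b)) :
    β a = a ∧ Perm.Disjoint β γ := by
  refine ⟨(h a).resolve_right ?_, fun x => (h x).imp_right fun hx => ?_⟩
  · rw [Perm.mul_apply, swap_apply_left, hb]
    exact hab.symm
  · by_cases hxa : x = a
    · rwa [hxa]
    by_cases hxb : x = b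
    · rwa [hxb]
    rwa [Perm.mul_apply, swap_apply_of_ne_of_ne hxa hxb] at hx

theorem twiceGenus_le_twiceGenus_mul [Finite D] (σ : Perm D) {β γ : Perm D}
    (hγ : Function.Involutive γ) (h : Perm.Disjoint β γ) :
    twiceGenus σ β ≤ twiceGenus σ (β * γ) := by
  classical
  refine involution_induction
    (p := fun γ => Perm.Disjoint β γ → twiceGenus σ β ≤ twiceGenus σ (β * γ)) ?_ ?_ γ hγ h
  · exact fun _ => by rw [mul_one]
  · intro γ a b hab ha hb ih hdisj
    obtain ⟨hβa, hβγ⟩ := disjoint_of_disjoint_mul_swap hab ha hb hdisj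
    have hstep := twiceGenus_mul_swap σ (α := β * γ) hab (by rw [Perm.mul_apply, ha, hβa])
    rw [mul_assoc] at hstep
    have hle := ih hβγ
    omega

theorem exists_twiceGenus_eq [Finite D] (σ : Perm D) {α : Perm D} (hα : Function.Involutive α) :
    ∃ g : ℕ, twiceGenus σ α = 2 * g := by
  classical
  refine involution_induction (p := fun α => ∃ g : ℕ, twiceGenus σ α = 2 * g) ?_ ?_ α hα
  · exact ⟨0, by rw [twiceGenus_one, Nat.cast_zero, mul_zero]⟩
  · rintro γ a b hab ha - ⟨g, hg⟩
    rcases twiceGenus_mul_swap σ hab ha with h | h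
    · exact ⟨g, h.trans hg⟩
    · exact ⟨g + 1, by rw [h, hg]; push_cast; ring⟩

theorem two_mul_numCycles_of_involutive [Finite D] {α : Perm D} (hα : Function.Involutive α) :
    2 * numCycles α = Nat.card D + {x | α x = x}.ncard := by
  classical
  refine involution_induction
    (p := fun α => 2 * numCycles α = Nat.card D + {x | α x = x}.ncard) ?_ ?_ α hα
  · simp only [numCycles, sameCycle_setoid_one, numClasses_bot, one_apply, Set.ofPred_true,
      Set.ncard_univ, two_mul]
  · intro γ a b hab ha hb ih
    have hcycles := numCycles_mul_swap_of_not_sameCycle (not_sameCycle_of_apply_eq_self hab ha)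
    have hfixed : {x | γ x = x} = insert a (insert b {x | (γ * swap a b) x = x}) := by
      ext x
      simp only [Set.mem_ofPred_eq, Set.mem_insert_iff]
      by_cases hxa : x = a
      · simp [hxa, ha]
      by_cases hxb : x = b
      · simp [hxb, hb]
      simp [hxa, hxb, swap_apply_of_ne_of_ne hxa hxb]
    rw [hfixed, Set.ncard_insert_of_notMem (by simp [hab, hb, hab.symm]),
      Set.ncard_insert_of_notMem (by simp [ha, hab])] at ih
    omega

theorem two_mul_numCycles_of_forall_ne [Finite D] {α : Perm D} (hα : Function.Involutive α)
    (hne : ∀ x, α x ≠ x) : 2 * numCycles α = Nat.card D := by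
  have hempty : {x | α x = x} = ∅ := Set.eq_empty_of_forall_notMem hne
  rw [two_mul_numCycles_of_involutive hα, hempty, Set.ncard_empty, add_zero]

end CombinatorialMaps

section InducedPermutations

variable {D X : Type*}

theorem numCycles_le_ncard_image_add [Finite D] {σ β π : Perm D} {T : Set D}
    (hπ : ∀ x ∉ T, π x = σ x) (hβ : ∀ x ∉ T, β x = x) (hT : ∀ x ∈ T, β x ∈ T) :
    numCycles π ≤ (Quotient.mk (SameCycle.setoid π) '' T).ncard +
      numClasses (jointOrbits σ β) := by
  classical
  set B := Quotient.mk (SameCycle.setoid π) '' T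
  let collapse (x : D) : Option (Quotient (SameCycle.setoid π)) :=
    if Quotient.mk _ x ∈ B then none else some (Quotient.mk _ x)
  have collapse_of_mem {x : D} (hx : x ∈ T) : collapse x = none := if_pos ⟨x, hx, rfl⟩
  have hcollapse {x y : D} (h : SameCycle π x y) : collapse x = collapse y := by
    simp only [collapse, Quotient.sound (s := SameCycle.setoid π) h]
  have hσ (x : D) : collapse x = collapse (σ x) := by
    by_cases hx : x ∈ T
    · have hpre : π.symm (σ x) ∈ T := by
        by_contra hpre
        have hπσ := hπ _ hpre
        rw [apply_symm_apply] at hπσ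
        exact hpre (σ.injective hπσ ▸ hx)
      rw [collapse_of_mem hx, ← collapse_of_mem hpre]
      exact hcollapse (sameCycle_symm_apply_left.2 (SameCycle.refl π (σ x)))
    · exact hπ x hx ▸ hcollapse (sameCycle_apply_right.2 (SameCycle.refl π x))
  have hcollapseβ (x : D) : collapse x = collapse (β x) := by
    by_cases hx : x ∈ T
    · rw [collapse_of_mem hx, collapse_of_mem (hT x hx)]
    · rw [hβ x hx]
  have hsub : ∀ q ∈ Bᶜ, some q ∈ Set.range collapse := fun q hq => by
    induction q using Quotient.inductionOn with | _ x => exact ⟨x, if_neg hq⟩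
  have hrange : (Set.range collapse).ncard ≤ numClasses (jointOrbits σ β) :=
    ncard_range_le_numClasses (jointOrbits_le hσ hcollapseβ)
  have hcompl := Set.ncard_le_ncard_of_injOn Option.some hsub (Option.some_injective _).injOn
  have hsum := Set.ncard_add_ncard_compl B
  rw [numCycles, numClasses, ← hsum]
  omega

/-- `ρ` is the permutation of `X` that `σ` induces along `ι`: it sends `x` to the first point of
`X` that `σ` meets after `x`. -/
def IsInducedPerm (ι : X → D) (σ : Perm D) (ρ : Perm X) : Prop :=
  ∀ x, ∃ k, IsFirstReturn σ (Set.range ι) (ι x) k ∧ (σ ^ k) (ι x) = ι (ρ x)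

theorem exists_isInducedPerm [Finite D] {ι : X → D} (hι : Function.Injective ι) (σ : Perm D) :
    ∃ ρ : Perm X, IsInducedPerm ι σ ρ := by
  have : Finite X := Finite.of_injective ι hι
  choose k hk using fun x =>
    exists_isFirstReturn (SameCycle.refl σ (ι x)) (Set.mem_range_self x)
  choose ρ hρ using fun x => (hk x).mem
  have eq_of_le {x y : X} (hxy : ρ x = ρ y) (hle : k x ≤ k y) : x = y := by
    have hpow : (σ ^ (k y - k x)) (ι y) = ι x := by
      apply (σ ^ k x).injective
      rw [← Perm.mul_apply, ← pow_add, Nat.add_sub_cancel' hle, ← hρ, ← hρ, hxy]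
    rcases Nat.eq_zero_or_pos (k y - k x) with h0 | hpos
    · rw [h0] at hpow
      exact (hι hpow).symm
    · exact absurd ⟨x, hpow.symm⟩ ((hk y).notMem _ hpos (Nat.sub_lt (hk y).pos (hk x).pos))
  have hinj : Function.Injective ρ := fun x y hxy =>
    (le_total (k x) (k y)).elim (eq_of_le hxy) fun hle => (eq_of_le hxy.symm hle).symm
  exact ⟨Equiv.ofBijective ρ (Finite.injective_iff_bijective.1 hinj),
    fun x => ⟨k x, hk x, (hρ x).symm⟩⟩

namespace IsInducedPerm

variable {ι : X → D} {σ : Perm D} {ρ : Perm X}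

theorem sameCycle_of_pow_eq (h : IsInducedPerm ι σ ρ) (hι : Function.Injective ι) {x y : X}
    {n : ℕ} (hn : (σ ^ n) (ι x) = ι y) : SameCycle ρ x y := by
  induction n using Nat.strong_induction_on generalizing x with
  | _ n ih =>
  rcases Nat.eq_zero_or_pos n with rfl | hpos
  · exact hι hn ▸ SameCycle.refl ρ x
  · obtain ⟨k, hk, hρ⟩ := h x
    have hkn : k ≤ n := by
      by_contra! hlt
      exact hk.notMem n hpos hlt ⟨y, hn.symm⟩
    refine sameCycle_apply_left.1 (ih (n - k) (Nat.sub_lt hpos hk.pos) ?_)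
    rw [← hρ, ← Perm.mul_apply, ← pow_add, Nat.sub_add_cancel hkn, hn]

theorem sameCycle_iff [Finite D] (h : IsInducedPerm ι σ ρ) (hι : Function.Injective ι) {x y : X} :
    SameCycle ρ x y ↔ SameCycle σ (ι x) (ι y) := by
  constructor
  · refine fun hxy => sameCycle_setoid_le (r := (SameCycle.setoid σ).comap ι) (fun x => ?_) hxy
    obtain ⟨k, -, hk⟩ := h x
    exact ⟨k, hk⟩
  · intro hxy
    obtain ⟨n, hn⟩ := hxy.exists_nat_pow_eq
    exact h.sameCycle_of_pow_eq hι hn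

theorem ncard_image_range [Finite D] (h : IsInducedPerm ι σ ρ) (hι : Function.Injective ι) :
    (Quotient.mk (SameCycle.setoid σ) '' Set.range ι).ncard = numCycles ρ := by
  have hker : SameCycle.setoid ρ = Setoid.ker (Quotient.mk (SameCycle.setoid σ) ∘ ι) :=
    Setoid.ext fun x y => (h.sameCycle_iff hι).trans
      (Quotient.eq (r := SameCycle.setoid σ) (x := ι x) (y := ι y)).symm
  rw [← Set.range_comp, ncard_range_eq_numClasses, ← hker, numCycles]

theorem mul_right (h : IsInducedPerm ι σ ρ) {β : Perm D} {α : Perm X}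
    (hβ : ∀ y ∉ Set.range ι, β y = y) (hα : ∀ x, β (ι x) = ι (α x)) :
    IsInducedPerm ι (σ * β) (ρ * α) := by
  intro x
  obtain ⟨k, hk, hρ⟩ := h (α x)
  rw [← hα] at hk hρ
  exact ⟨k, hk.mul_right hβ, (hk.mul_pow_apply hβ hk.pos le_rfl).trans hρ⟩

end IsInducedPerm

theorem card_le_two_mul_twiceGenus_viaEmbedding [Finite D] {ι : X ↪ D} {σ : Perm D} {ρ α : Perm X}
    (hα : Function.Involutive α) (hne : ∀ x, α x ≠ x) (hρ : IsInducedPerm ι σ ρ) :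
    (Nat.card X : ℤ) ≤ 2 * twiceGenus σ (α.viaEmbedding ι) + 2 * numCycles ρ +
      2 * numCycles (ρ * α) := by
  set β := α.viaEmbedding ι
  have hβ : ∀ y ∉ Set.range ι, β y = y := α.viaEmbedding_apply_of_notMem ι
  have hβι (x : X) : β (ι x) = ι (α x) := α.viaEmbedding_apply ι x
  have hβT : ∀ y ∈ Set.range ι, β y ∈ Set.range ι := by
    rintro _ ⟨x, rfl⟩
    exact ⟨α x, (hβι x).symm⟩
  have hβinv : Function.Involutive β := fun y => by
    by_cases hy : y ∈ Set.range ι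
    · obtain ⟨x, rfl⟩ := hy
      rw [hβι, hβι, hα]
    · rw [hβ y hy, hβ y hy]
  have hfixed : {y | β y = y} = (Set.range ι)ᶜ := by
    ext y
    refine ⟨?_, hβ y⟩
    rintro hy ⟨x, rfl⟩
    exact hne x (ι.injective ((hβι x).symm.trans hy))
  have hvertices := numCycles_le_ncard_image_add (π := σ) (fun _ _ => rfl) hβ hβT
  have hfaces := numCycles_le_ncard_image_add (σ := σ) (π := σ * β)
    (fun y hy => congrArg σ (hβ y hy)) hβ hβT
  rw [hρ.ncard_image_range ι.injective] at hvertices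
  rw [(hρ.mul_right hβ hβι).ncard_image_range ι.injective] at hfaces
  have hedges := two_mul_numCycles_of_involutive hβinv
  have hcard := Set.ncard_add_ncard_compl (Set.range ι)
  rw [← Nat.card_coe_set_eq (Set.range ι),
    ← Nat.card_congr (Equiv.ofInjective ι ι.injective)] at hcard
  rw [hfixed] at hedges
  rw [twiceGenus]
  omega

theorem twiceGenus_viaEmbedding_le [Finite D] (σ : Perm D) {ι : X ↪ D} {α : Perm D} {α' : Perm X}
    (hα : Function.Involutive α) (hι : ∀ x, ι (α' x) = α (ι x)) :
    twiceGenus σ (α'.viaEmbedding ι) ≤ twiceGenus σ α := by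
  set β := α'.viaEmbedding ι
  have hβ : ∀ y ∉ Set.range ι, β y = y := α'.viaEmbedding_apply_of_notMem ι
  have hβι (x : X) : β (ι x) = α (ι x) := (α'.viaEmbedding_apply ι x).trans (hι x)
  have hmem (y : D) (hy : α y ∈ Set.range ι) : y ∈ Set.range ι := by
    obtain ⟨x, hx⟩ := hy
    exact ⟨α' x, by rw [hι, hx, hα]⟩
  have honrange (x : X) : (β⁻¹ * α) (ι x) = ι x := by
    rw [Perm.mul_apply, inv_eq_iff_eq, hβι]
  have hoffrange (y : D) (hy : y ∉ Set.range ι) : (β⁻¹ * α) y = α y := by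
    rw [Perm.mul_apply, inv_eq_iff_eq, hβ _ fun h => hy (hmem y h)]
  have hinv : Function.Involutive (β⁻¹ * α) := fun y => by
    by_cases hy : y ∈ Set.range ι
    · obtain ⟨x, rfl⟩ := hy
      rw [honrange, honrange]
    · rw [hoffrange y hy, hoffrange _ fun h => hy (hmem y h), hα]
  have hdisj : Perm.Disjoint β (β⁻¹ * α) := fun y => by
    by_cases hy : y ∈ Set.range ι
    · obtain ⟨x, rfl⟩ := hy
      exact Or.inr (honrange x)
    · exact Or.inl (hβ y hy)
  have hle := twiceGenus_le_twiceGenus_mul σ hinv hdisj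
  rwa [mul_inv_cancel_left] at hle

end InducedPermutations

section CompletionToCellSurface

theorem exists_sameCycle_setoid_eq {D : Type*} [Finite D] (r : Setoid D) :
    ∃ σ : Perm D, SameCycle.setoid σ = r := by
  classical
  obtain ⟨σ, hσ, hmin⟩ := Set.exists_min_image {σ : Perm D | SameCycle.setoid σ ≤ r} numCycles
    (Set.toFinite _) ⟨1, sameCycle_setoid_one.trans_le bot_le⟩
  refine ⟨σ, le_antisymm hσ fun a b hab => ?_⟩
  by_contra h
  have hlt := numCycles_mul_swap_of_not_sameCycle h
  have hle := hmin (σ * swap a b) ((sameCycle_setoid_mul_swap h).trans_le (glueClasses_le hσ hab))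
  omega

theorem jointOrbits_iff {D : Type*} {σ α : Perm D} {a b : D} :
    jointOrbits σ α a b ↔ ∃ τ ∈ Subgroup.closure {σ, α}, τ a = b := by
  constructor
  · intro h
    have hle : jointOrbits σ α ≤ MulAction.orbitRel (Subgroup.closure {σ, α}) D :=
      jointOrbits_le
        (fun x => (MulAction.orbitRel _ D).symm
          ⟨⟨σ, Subgroup.subset_closure (Set.mem_insert _ _)⟩, rfl⟩)
        (fun x => (MulAction.orbitRel _ D).symm
          ⟨⟨α, Subgroup.subset_closure (Set.mem_insert_of_mem _ rfl)⟩, rfl⟩)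
    obtain ⟨⟨τ, hτ⟩, h⟩ := (MulAction.orbitRel _ D).symm (hle h)
    exact ⟨τ, hτ, h⟩
  · rintro ⟨τ, hτ, rfl⟩
    induction hτ using Subgroup.closure_induction generalizing a with
    | mem τ hτ =>
      rcases hτ with rfl | rfl
      · exact jointOrbits_apply_left _ α a
      · exact jointOrbits_apply_right σ _ a
    | one => exact (jointOrbits σ α).refl a
    | mul τ υ _ _ ihτ ihυ => exact (jointOrbits σ α).trans ihυ ihτ
    | inv τ _ ih =>
      have h := ih (a := τ⁻¹ a)
      rw [← Perm.mul_apply, mul_inv_cancel, one_apply] at h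
      exact (jointOrbits σ α).symm h

theorem CellSurface.hasGenus_iff (S : CellSurface) {g : ℕ} :
    S.HasGenus g ↔ twiceGenus S.rot S.rev = 2 * g := by
  have hconn : jointOrbits S.rot S.rev = ⊤ :=
    top_le_iff.1 fun a b _ => jointOrbits_iff.2 (S.connected a b)
  have hedges := two_mul_numCycles_of_forall_ne S.rev_rev S.rev_ne
  change (numCycles S.rot : ℤ) - numCycles S.rev + numCycles (S.rot * S.rev) = 2 - 2 * g ↔ _
  rw [twiceGenus, hconn, numClasses_top]
  omega

variable {D C : Type*} (r : C ↪ D) (σ α : Perm D) (π : Perm C)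

/-- The rotation `σ` with a new dart `Sum.inr (Sum.inl i)` inserted after every `r i`, and with a
new vertex, the hub, whose darts `Sum.inr (Sum.inr i)` are permuted by `π`. -/
noncomputable def hubRot : Perm (D ⊕ C ⊕ C) :=
  Equiv.sumCongr σ (Equiv.sumCongr 1 π) *
    Perm.viaEmbedding (sumComm C C) (r.sumMap ⟨Sum.inl, Sum.inl_injective⟩)

/-- The reversal of darts that extends `α` and joins the new darts at the old vertices to the
hub. -/
def hubRev (C : Type*) : Perm (D ⊕ C ⊕ C) :=
  Equiv.sumCongr α (sumComm C C)

theorem hubRot_inl_apply (i : C) : hubRot r σ π (Sum.inl (r i)) = Sum.inr (Sum.inl i) := by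
  rw [hubRot, Perm.mul_apply]
  exact congrArg _ (viaEmbedding_apply (sumComm C C) _ (Sum.inl i))

theorem hubRot_inr_inl (i : C) : hubRot r σ π (Sum.inr (Sum.inl i)) = Sum.inl (σ (r i)) := by
  rw [hubRot, Perm.mul_apply]
  exact congrArg _ (viaEmbedding_apply (sumComm C C) _ (Sum.inr i))

theorem hubRot_inl_of_notMem {a : D} (ha : a ∉ Set.range r) :
    hubRot r σ π (Sum.inl a) = Sum.inl (σ a) := by
  rw [hubRot, Perm.mul_apply, viaEmbedding_apply_of_notMem]
  · rfl
  · rintro ⟨i | i, hi⟩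
    · exact ha ⟨i, Sum.inl_injective hi⟩
    · exact Sum.inr_ne_inl hi

theorem hubRot_inr_inr (i : C) : hubRot r σ π (Sum.inr (Sum.inr i)) = Sum.inr (Sum.inr (π i)) := by
  rw [hubRot, Perm.mul_apply, viaEmbedding_apply_of_notMem]
  · rfl
  · rintro ⟨i | i, hi⟩
    · exact Sum.inl_ne_inr hi
    · exact Sum.inl_ne_inr (Sum.inr_injective hi)

/-- The vertex of a dart of `hubRot r σ π`, as a cycle of `σ`, or `none` for the hub. -/
def hubVertex : D ⊕ C ⊕ C → Option (Quotient (SameCycle.setoid σ)) :=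
  Sum.elim (fun a => some (Quotient.mk _ a)) (Sum.elim (fun i => some (Quotient.mk _ (r i)))
    fun _ => none)

theorem hubVertex_hubRot (x : D ⊕ C ⊕ C) :
    hubVertex r σ (hubRot r σ π x) = hubVertex r σ x := by
  have hσ (a : D) : Quotient.mk (SameCycle.setoid σ) (σ a) = Quotient.mk _ a :=
    Quotient.sound (sameCycle_apply_left.2 (SameCycle.refl σ a))
  rcases x with a | i | i
  · by_cases ha : a ∈ Set.range r
    · obtain ⟨i, rfl⟩ := ha
      rw [hubRot_inl_apply]
      rfl
    · rw [hubRot_inl_of_notMem r σ π ha]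
      exact congrArg some (hσ a)
  · rw [hubRot_inr_inl]
    exact congrArg some (hσ (r i))
  · rw [hubRot_inr_inr]
    rfl

theorem numCycles_add_one_le_numCycles_hubRot [Finite D] [Finite C] [Nonempty C] :
    numCycles σ + 1 ≤ numCycles (hubRot r σ π) := by
  have hsurj : Function.Surjective (hubVertex r σ) := by
    rintro (_ | q)
    · exact ⟨Sum.inr (Sum.inr (Classical.arbitrary C)), rfl⟩
    · induction q using Quotient.inductionOn with | _ a => exact ⟨Sum.inl a, rfl⟩
  have hle := ncard_range_le_numCycles (hubVertex_hubRot r σ π)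
  rwa [hsurj.range_eq, Set.ncard_univ, Finite.card_option] at hle

theorem sameCycle_hubRot_inl_iff {a b : D} :
    SameCycle (hubRot r σ π) (Sum.inl a) (Sum.inl b) ↔ SameCycle σ a b := by
  constructor
  · intro h
    have hvertex := sameCycle_setoid_le (r := Setoid.ker (hubVertex r σ))
      (fun x => (hubVertex_hubRot r σ π x).symm) h
    exact Quotient.exact (Option.some_injective _ hvertex)
  · refine fun h => sameCycle_setoid_le
      (r := (SameCycle.setoid (hubRot r σ π)).comap Sum.inl) (fun a => ?_) h
    by_cases ha : a ∈ Set.range r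
    · obtain ⟨i, rfl⟩ := ha
      exact ⟨2, by rw [zpow_two, Perm.mul_apply, hubRot_inl_apply, hubRot_inr_inl]⟩
    · exact ⟨1, by rw [zpow_one, hubRot_inl_of_notMem r σ π ha]⟩

theorem jointOrbits_hubRot_hubRev_eq_top (hr : ∀ a, ∃ i, jointOrbits σ α a (r i))
    (hπ : SameCycle.setoid π = ⊤) : jointOrbits (hubRot r σ π) (hubRev α C) = ⊤ := by
  set s := jointOrbits (hubRot r σ π) (hubRev α C)
  have hrot (x : D ⊕ C ⊕ C) : s x (hubRot r σ π x) := jointOrbits_apply_left _ _ x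
  have hrev (x : D ⊕ C ⊕ C) : s x (hubRev α C x) := jointOrbits_apply_right _ _ x
  have hold {a b : D} (h : jointOrbits σ α a b) : s (Sum.inl a) (Sum.inl b) :=
    jointOrbits_le (r := s.comap Sum.inl) (fun a => (le_sup_left : _ ≤ s)
      ((sameCycle_hubRot_inl_iff r σ π).2 (sameCycle_apply_right.2 (SameCycle.refl σ a))))
      (fun a => hrev (Sum.inl a)) h
  have hhub (i j : C) : s (Sum.inr (Sum.inr i)) (Sum.inr (Sum.inr j)) :=
    sameCycle_setoid_le (r := s.comap (Sum.inr ∘ Sum.inr))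
      (fun i => by simpa only [hubRot_inr_inr] using! hrot (Sum.inr (Sum.inr i)))
      (hπ.ge trivial : SameCycle.setoid π i j)
  have hspoke (i : C) : s (Sum.inl (r i)) (Sum.inr (Sum.inr i)) :=
    s.trans (by simpa only [hubRot_inl_apply] using hrot (Sum.inl (r i)))
      (hrev (Sum.inr (Sum.inl i)))
  have hall (x : D ⊕ C ⊕ C) : ∃ i, s x (Sum.inr (Sum.inr i)) := by
    rcases x with a | i | i
    · obtain ⟨i, hi⟩ := hr a
      exact ⟨i, s.trans (hold hi) (hspoke i)⟩
    · exact ⟨i, hrev (Sum.inr (Sum.inl i))⟩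
    · exact ⟨i, s.refl _⟩
  refine top_le_iff.1 fun x y _ => ?_
  obtain ⟨i, hi⟩ := hall x
  obtain ⟨j, hj⟩ := hall y
  exact s.trans hi (s.trans (hhub i j) (s.symm hj))

open scoped Classical in
/-- The face of a dart of `hubRot r σ π`, as a cycle of `σ * α`, or `none` if that cycle is one of
those cut open by the new edges. -/
noncomputable def hubFace : D ⊕ C ⊕ C → Option (Quotient (SameCycle.setoid (σ * α))) :=
  Sum.elim (fun a => let face : D → Quotient (SameCycle.setoid (σ * α)) := Quotient.mk _
    if face a ∈ Set.range fun i => face (α (r i)) then none else some (face a)) fun _ => none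

variable {α} in
theorem hubFace_hubRot_mul_hubRev (hα : Function.Involutive α) (x : D ⊕ C ⊕ C) :
    hubFace r σ α ((hubRot r σ π * hubRev α C) x) = hubFace r σ α x := by
  classical
  have hcut (a : D) (i : C) (h : SameCycle (σ * α) (α (r i)) a) :
      hubFace r σ α (Sum.inl a) = none := if_pos ⟨i, Quotient.sound h⟩
  rw [Perm.mul_apply]
  rcases x with a | i | i
  · change hubFace r σ α (hubRot r σ π (Sum.inl (α a))) = _
    by_cases ha : α a ∈ Set.range r
    · obtain ⟨i, hi⟩ := ha
      rw [hcut a i (by rw [hi, hα a]), ← hi, hubRot_inl_apply]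
      rfl
    · have hface : SameCycle (σ * α) (σ (α a)) a :=
        (sameCycle_apply_left (f := σ * α)).2 (SameCycle.refl _ a)
      rw [hubRot_inl_of_notMem r σ π ha]
      exact congrArg (fun q : Quotient (SameCycle.setoid (σ * α)) =>
        if q ∈ Set.range fun i => Quotient.mk _ (α (r i)) then none else some q)
        (Quotient.sound hface)
  · change hubFace r σ α (hubRot r σ π (Sum.inr (Sum.inr i))) = none
    rw [hubRot_inr_inr]
    rfl
  · change hubFace r σ α (hubRot r σ π (Sum.inr (Sum.inl i))) = none
    rw [hubRot_inr_inl]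
    refine hcut _ i ?_
    simpa only [Perm.mul_apply, hα (r i)] using
      (sameCycle_apply_right (f := σ * α)).2 (SameCycle.refl _ (α (r i)))

variable {α} in
theorem numCycles_add_one_le_numCycles_hubRot_mul_hubRev [Finite D] [Finite C] [Nonempty C]
    (hα : Function.Involutive α) :
    numCycles (σ * α) + 1 ≤ numCycles (hubRot r σ π * hubRev α C) + Nat.card C := by
  set M : Set (Quotient (SameCycle.setoid (σ * α))) := Set.range fun i => Quotient.mk _ (α (r i))
  have hM : M.ncard ≤ Nat.card C := by
    rw [← Nat.card_coe_set_eq]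
    exact Finite.card_range_le _
  have hsub : insert none (some '' Mᶜ) ⊆ Set.range (hubFace r σ α) := by
    rintro _ (rfl | ⟨q, hq, rfl⟩)
    · exact ⟨Sum.inr (Sum.inl (Classical.arbitrary C)), rfl⟩
    · induction q using Quotient.inductionOn with | _ a =>
      exact ⟨Sum.inl a, if_neg hq⟩
  have hcard := Set.ncard_le_ncard hsub
  rw [Set.ncard_insert_of_notMem (by rintro ⟨_, _, ⟨⟩⟩),
    Set.ncard_image_of_injective _ (Option.some_injective _)] at hcard
  have hrange := ncard_range_le_numCycles (hubFace_hubRot_mul_hubRev r σ π hα)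
  have hcompl := Set.ncard_add_ncard_compl M
  rw [numCycles, numClasses]
  omega

variable {α} in
theorem hubRev_involutive (hα : Function.Involutive α) : Function.Involutive (hubRev α C) := by
  rintro (a | i | i)
  · exact congrArg Sum.inl (hα a)
  · rfl
  · rfl

variable {α} in
theorem hubRev_ne (hα : ∀ a, α a ≠ a) : ∀ x, hubRev α C x ≠ x := by
  rintro (a | i | i) h
  · exact hα a (Sum.inl_injective h)
  · exact Sum.inr_ne_inl (Sum.inr_injective h)
  · exact Sum.inl_ne_inr (Sum.inr_injective h)

variable {α} in
theorem twiceGenus_hubRot_hubRev_le [Finite D] [Finite C] [Nonempty C]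
    (hα : Function.Involutive α) (hne : ∀ a, α a ≠ a)
    (hC : Nat.card C = numClasses (jointOrbits σ α)) (hr : ∀ a, ∃ i, jointOrbits σ α a (r i))
    (hπ : SameCycle.setoid π = ⊤) :
    twiceGenus (hubRot r σ π) (hubRev α C) ≤ twiceGenus σ α := by
  have hvertices := numCycles_add_one_le_numCycles_hubRot r σ π
  have hfaces := numCycles_add_one_le_numCycles_hubRot_mul_hubRev r σ π hα
  have hedges := two_mul_numCycles_of_forall_ne hα hne
  have hhubEdges := two_mul_numCycles_of_forall_ne (hubRev_involutive (C := C) hα) (hubRev_ne hne)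
  rw [Nat.card_sum, Nat.card_sum] at hhubEdges
  rw [twiceGenus, twiceGenus, jointOrbits_hubRot_hubRev_eq_top r σ α π hr hπ, numClasses_top,
    Nat.card_sum, Nat.card_sum]
  omega

end CompletionToCellSurface

theorem exists_cellSurface_twiceGenus_le {D : Type} [Finite D] [Nonempty D] (σ : Perm D)
    {α : Perm D} (hα : Function.Involutive α) (hne : ∀ a, α a ≠ a) :
    ∃ (S : CellSurface) (ι : D ↪ S.Dart), (∀ a, S.rev (ι a) = ι (α a)) ∧
      (∀ a b, SameCycle S.rot (ι a) (ι b) ↔ SameCycle σ a b) ∧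
      twiceGenus S.rot S.rev ≤ twiceGenus σ α := by
  classical
  set C := Quotient (jointOrbits σ α)
  let r : C ↪ D := ⟨Quotient.out, Quotient.out_injective⟩
  have : Nonempty C := ⟨Quotient.mk _ (Classical.arbitrary D)⟩
  obtain ⟨π, hπ⟩ := exists_sameCycle_setoid_eq (⊤ : Setoid C)
  have hr (a : D) : ∃ i, jointOrbits σ α a (r i) :=
    ⟨Quotient.mk _ a, (jointOrbits σ α).symm (Quotient.mk_out a)⟩
  have := Fintype.ofFinite (D ⊕ C ⊕ C)
  let S : CellSurface :=
    { Dart := D ⊕ C ⊕ C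
      rot := hubRot r σ π
      rev := hubRev α C
      rev_rev := hubRev_involutive hα
      rev_ne := hubRev_ne hne
      connected := fun a b => jointOrbits_iff.1
        ((jointOrbits_hubRot_hubRev_eq_top r σ α π hr hπ).ge trivial) }
  exact ⟨S, ⟨Sum.inl, Sum.inl_injective⟩, fun a => rfl, fun a b => sameCycle_hubRot_inl_iff r σ π,
    twiceGenus_hubRot_hubRev_le r σ π hα hne rfl hr hπ⟩

section RotationSystems

variable {V : Type*} {G : SimpleGraph V}

instance finite_dart [Finite V] : Finite G.Dart :=
  Finite.of_injective _ SimpleGraph.Dart.toProd_injective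

/-- The permutation that reverses the darts of a graph. -/
def dartRev (G : SimpleGraph V) : Perm G.Dart :=
  SimpleGraph.Dart.symm_involutive.toPerm

theorem dartRev_involutive : Function.Involutive (dartRev G) :=
  SimpleGraph.Dart.symm_involutive

theorem dartRev_ne (a : G.Dart) : dartRev G a ≠ a := a.symm_ne

/-- A rotation system of a graph: a cyclic order of the darts at each vertex, given by a
permutation whose cycles are the sets of darts that leave a common vertex. -/
structure RotationSystem (G : SimpleGraph V) where
  rot : Perm G.Dart
  sameCycle_iff : ∀ a b, SameCycle rot a b ↔ a.fst = b.fst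

namespace RotationSystem

theorem nonempty [Finite V] (G : SimpleGraph V) : Nonempty (RotationSystem G) := by
  obtain ⟨σ, hσ⟩ := exists_sameCycle_setoid_eq (Setoid.ker fun a : G.Dart => a.fst)
  exact ⟨σ, fun a b => Setoid.ext_iff.1 hσ a b⟩

variable (R : RotationSystem G)

/-- The number of faces of the embedding that a rotation system defines. -/
noncomputable def numFaces : ℕ := numCycles (R.rot * dartRev G)

theorem fst_rot (a : G.Dart) : (R.rot a).fst = a.fst :=
  (R.sameCycle_iff _ _).1 (sameCycle_apply_left.2 (SameCycle.refl R.rot a))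

theorem ker_fst_eq : Setoid.ker (fun a : G.Dart => a.fst) = SameCycle.setoid R.rot :=
  Setoid.ext fun a b => (R.sameCycle_iff a b).symm

theorem numCycles_rot_le [Finite V] : numCycles R.rot ≤ Nat.card V := by
  rw [numCycles, ← R.ker_fst_eq, ← ncard_range_eq_numClasses]
  exact Set.ncard_le_card _

theorem numCycles_rot (hG : ∀ v, (G.neighborSet v).Nonempty) :
    numCycles R.rot = Nat.card V := by
  have hsurj : Function.Surjective fun a : G.Dart => a.fst := fun v =>
    let ⟨w, hw⟩ := hG v
    ⟨⟨(v, w), hw⟩, rfl⟩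
  rw [numCycles, ← R.ker_fst_eq, ← ncard_range_eq_numClasses, hsurj.range_eq, Set.ncard_univ]

theorem rot_ne (hG : ∀ v, (G.neighborSet v).Nontrivial) (a : G.Dart) : R.rot a ≠ a := by
  intro ha
  obtain ⟨w, hw, hwa⟩ := (hG a.fst).exists_ne a.snd
  have h : SameCycle R.rot a ⟨(a.fst, w), hw⟩ := (R.sameCycle_iff _ _).2 rfl
  exact hwa (congrArg (fun b : G.Dart => b.snd) (h.eq_of_left ha)).symm

theorem rot_involutive (hG : ∀ v, (G.neighborSet v).ncard = 2) :
    Function.Involutive R.rot := by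
  have hnontrivial (v : V) : (G.neighborSet v).Nontrivial :=
    Set.one_lt_ncard_iff_nontrivial_and_finite.1 (by rw [hG v]; decide) |>.1
  intro a
  by_contra hne
  have hsnd {b c : G.Dart} (hbc : b ≠ c) (hfst : b.fst = c.fst) : b.snd ≠ c.snd := fun h =>
    hbc (SimpleGraph.Dart.ext _ _ (Prod.ext hfst h))
  have hmem {b : G.Dart} (hb : b.fst = a.fst) : b.snd ∈ G.neighborSet a.fst := hb ▸ b.adj
  have hfst : (R.rot (R.rot a)).fst = a.fst := (R.fst_rot _).trans (R.fst_rot a)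
  have hlt : 2 < (G.neighborSet a.fst).ncard :=
    (Set.two_lt_ncard_iff (Set.finite_of_ncard_ne_zero (by rw [hG]; decide))).2
      ⟨a.snd, (R.rot a).snd, (R.rot (R.rot a)).snd, hmem rfl, hmem (R.fst_rot a), hmem hfst,
        hsnd (R.rot_ne hnontrivial a).symm (R.fst_rot a).symm, hsnd (Ne.symm hne) hfst.symm,
        hsnd (R.rot_ne hnontrivial _).symm (R.fst_rot _).symm⟩
  exact hlt.ne' (hG a.fst)

theorem exists_card_dart_le [Finite V] {S : CellSurface} (φ : G.Drawing S) {g : ℕ}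
    (hg : S.HasGenus g) :
    ∃ R : RotationSystem G, Nat.card G.Dart ≤ 4 * g + 2 * Nat.card V + 2 * R.numFaces := by
  classical
  obtain ⟨ρ, hρ⟩ := exists_isInducedPerm φ.dart_injective S.rot
  have hsource (a b : G.Dart) : SameCycle S.rot (φ.dart a) (φ.dart b) ↔ a.fst = b.fst := by
    rw [← φ.vert_injective.eq_iff, ← φ.source_dart, ← φ.source_dart]
    exact (Quotient.eq (r := SameCycle.setoid S.rot)).symm
  let R : RotationSystem G :=
    { rot := ρ
      sameCycle_iff := fun a b => (hρ.sameCycle_iff φ.dart_injective).trans (hsource a b) }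
  refine ⟨R, ?_⟩
  have hdarts := card_le_two_mul_twiceGenus_viaEmbedding (ι := ⟨φ.dart, φ.dart_injective⟩)
    (dartRev_involutive (G := G)) dartRev_ne hρ
  have hle := twiceGenus_viaEmbedding_le (ι := ⟨φ.dart, φ.dart_injective⟩) S.rot S.rev_rev
    (α' := dartRev G) φ.dart_symm
  have hvertices := R.numCycles_rot_le
  rw [S.hasGenus_iff] at hg
  change _ ≤ _ + 2 * (R.numFaces : ℤ) at hdarts
  change _ ≤ _ + 2 * (numCycles R.rot : ℤ) + _ at hdarts
  omega

theorem exists_drawing {V : Type} [Finite V] [Nonempty V] {G : SimpleGraph V}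
    (R : RotationSystem G) (hG : ∀ v, (G.neighborSet v).Nonempty) :
    ∃ (S : CellSurface) (g : ℕ), S.HasGenus g ∧ Nonempty (G.Drawing S) ∧
      2 * (g : ℤ) ≤ twiceGenus R.rot (dartRev G) := by
  choose w hw using hG
  let out (v : V) : G.Dart := ⟨(v, w v), hw v⟩
  have : Nonempty G.Dart := ⟨out (Classical.arbitrary V)⟩
  obtain ⟨S, ι, hrev, hrot, hle⟩ :=
    exists_cellSurface_twiceGenus_le R.rot (dartRev_involutive (G := G)) dartRev_ne
  obtain ⟨g, hg⟩ := exists_twiceGenus_eq S.rot S.rev_rev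
  have hsource (a b : G.Dart) : S.source (ι a) = S.source (ι b) ↔ a.fst = b.fst := by
    rw [← R.sameCycle_iff, ← hrot]
    exact Quotient.eq (r := SameCycle.setoid S.rot)
  let φ : G.Drawing S :=
    { vert := fun v => S.source (ι (out v))
      vert_injective := fun u v h => (hsource (out u) (out v)).1 h
      dart := ι
      dart_injective := ι.injective
      dart_symm := fun a => (hrev a).symm
      source_dart := fun a => (hsource a (out a.fst)).2 rfl }
  exact ⟨S, g, S.hasGenus_iff.2 hg, ⟨φ⟩, by omega⟩

variable {V : Type} [Finite V] [Nonempty V] {G : SimpleGraph V}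

theorem two_mul_genus_le_twiceGenus (R : RotationSystem G)
    (hG : ∀ v, (G.neighborSet v).Nonempty) : 2 * (G.genus : ℤ) ≤ twiceGenus R.rot (dartRev G) := by
  obtain ⟨S, g, hg, hφ, hle⟩ := R.exists_drawing hG
  have hgenus : G.genus ≤ g := Nat.sInf_le ⟨S, hg, hφ⟩
  omega

theorem four_mul_genus_add_le (R : RotationSystem G) (hG : ∀ v, (G.neighborSet v).Nonempty) :
    4 * G.genus + 2 * Nat.card V ≤ Nat.card G.Dart + 2 * R.numFaces := by
  have hgenus := R.two_mul_genus_le_twiceGenus hG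
  have hcomps : numClasses (jointOrbits R.rot (dartRev G)) ≤ R.numFaces :=
    numClasses_le_of_le (sameCycle_setoid_mul_le _ _)
  have hedges := two_mul_numCycles_of_forall_ne (dartRev_involutive (G := G)) dartRev_ne
  rw [twiceGenus, R.numCycles_rot hG, ← numFaces] at hgenus
  omega

theorem exists_card_dart_le_genus (hG : ∀ v, (G.neighborSet v).Nonempty) :
    ∃ R : RotationSystem G,
      Nat.card G.Dart ≤ 4 * G.genus + 2 * Nat.card V + 2 * R.numFaces := by
  obtain ⟨R⟩ := RotationSystem.nonempty G
  obtain ⟨S, g, hg, hφ, -⟩ := R.exists_drawing hG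
  obtain ⟨S, hgenus, ⟨φ⟩⟩ :=
    Nat.sInf_mem (s := {g | ∃ S : CellSurface, S.HasGenus g ∧ Nonempty (G.Drawing S)})
      ⟨g, S, hg, hφ⟩
  exact exists_card_dart_le φ hgenus

end RotationSystem

section DegreeTwo

variable {D : Type*} {σ α : Perm D}

theorem mul_pow_apply_involution (hσ : Function.Involutive σ) (hα : Function.Involutive α) (m : ℕ)
    (a : D) : ((σ * α) ^ m) (α (((σ * α) ^ m) a)) = α a := by
  induction m with
  | zero => rfl
  | succ m ih =>
    rw [pow_succ, Perm.mul_apply, ← pow_succ, pow_succ', Perm.mul_apply (σ * α) ((σ * α) ^ m),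
      Perm.mul_apply σ α, Perm.mul_apply σ α, hα, hσ, ih]

theorem not_sameCycle_mul_of_involutive [Finite D] (hσ : Function.Involutive σ)
    (hσ' : ∀ a, σ a ≠ a) (hα : Function.Involutive α) (hα' : ∀ a, α a ≠ a) (a : D) :
    ¬ SameCycle (σ * α) a (α a) := by
  intro h
  obtain ⟨k, hk⟩ := h.exists_nat_pow_eq
  rcases Nat.even_or_odd' k with ⟨m, rfl | rfl⟩
  · rw [two_mul, pow_add, Perm.mul_apply, ← mul_pow_apply_involution hσ hα m a] at hk
    exact hα' _ (((σ * α) ^ m).injective hk).symm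
  · rw [two_mul, add_assoc, pow_add, Perm.mul_apply, ← mul_pow_apply_involution hσ hα m a] at hk
    have h := ((σ * α) ^ m).injective hk
    rw [pow_succ', Perm.mul_apply, Perm.mul_apply] at h
    exact hσ' _ h

theorem two_mul_numClasses_le_numCycles_mul [Finite D] (hσ : Function.Involutive σ)
    (hσ' : ∀ a, σ a ≠ a) (hα : Function.Involutive α) (hα' : ∀ a, α a ≠ a) :
    2 * numClasses (jointOrbits σ α) ≤ numCycles (σ * α) := by
  let comp : D → Quotient (jointOrbits σ α) := Quotient.mk _
  let side (a : D) : Quotient (jointOrbits σ α) × Prop :=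
    (comp a, SameCycle (σ * α) (comp a).out a)
  have hcomp (a : D) : comp ((σ * α) a) = comp a := Quotient.sound <| (jointOrbits σ α).symm <|
    sameCycle_setoid_mul_le σ α (sameCycle_apply_right.2 (SameCycle.refl (σ * α) a))
  have hside (a : D) : side ((σ * α) a) = side a := by
    simp only [side, hcomp, sameCycle_apply_right]
  have hsurj : Function.Surjective side := by
    rintro ⟨q, p⟩
    by_cases hp : p
    · exact ⟨q.out, Prod.ext q.out_eq (by simp [side, comp, hp, SameCycle.refl])⟩
    · have hq : comp (α q.out) = q :=
        (Quotient.sound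
          ((jointOrbits σ α).symm (jointOrbits_apply_right σ α q.out))).trans q.out_eq
      refine ⟨α q.out, Prod.ext hq ?_⟩
      simp only [side, hq, hp, not_sameCycle_mul_of_involutive hσ hσ' hα hα']
  have hle := ncard_range_le_numCycles hside
  rwa [hsurj.range_eq, Set.ncard_univ, Nat.card_prod, Nat.card_eq_fintype_card (α := Prop),
    Fintype.card_prop, mul_comm] at hle

theorem twiceGenus_nonpos_of_involutive [Finite D] (hσ : Function.Involutive σ)
    (hσ' : ∀ a, σ a ≠ a) (hα : Function.Involutive α) (hα' : ∀ a, α a ≠ a) :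
    twiceGenus σ α ≤ 0 := by
  have hvertices := two_mul_numCycles_of_forall_ne hσ hσ'
  have hedges := two_mul_numCycles_of_forall_ne hα hα'
  have hfaces := two_mul_numClasses_le_numCycles_mul hσ hσ' hα hα'
  rw [twiceGenus]
  omega

end DegreeTwo

theorem genus_eq_zero_of_ncard_neighborSet_eq_two {V : Type} [Finite V] [Nonempty V]
    {G : SimpleGraph V} (hG : ∀ v, (G.neighborSet v).ncard = 2) : G.genus = 0 := by
  have hnontrivial (v : V) : (G.neighborSet v).Nontrivial := by
    rw [← Set.one_lt_ncard_iff_nontrivial, hG v]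
    exact Nat.one_lt_two
  obtain ⟨R⟩ := RotationSystem.nonempty G
  have hle := R.two_mul_genus_le_twiceGenus fun v => (hnontrivial v).nonempty
  have hnonpos := twiceGenus_nonpos_of_involutive (R.rot_involutive hG) (R.rot_ne hnontrivial)
    (dartRev_involutive (G := G)) dartRev_ne
  omega

theorem card_dart_of_ncard_neighborSet_eq [Finite V] {d : ℕ}
    (hG : ∀ v, (G.neighborSet v).ncard = d) : Nat.card G.Dart = Nat.card V * d := by
  classical
  have := Fintype.ofFinite V
  have hdegree (v : V) : G.degree v = d := by
    rw [← hG v, ← G.card_neighborSet_eq_degree, ← Nat.card_eq_fintype_card, Nat.card_coe_set_eq]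
  rw [Nat.card_eq_fintype_card, G.dart_card_eq_sum_degrees,
    Finset.sum_congr rfl fun v _ => hdegree v, Finset.sum_const, Finset.card_univ,
    ← Nat.card_eq_fintype_card, smul_eq_mul]

end RotationSystems

section ShortCycles

variable {V : Type*} {G : SimpleGraph V}

/-- The oriented edges `(a, b)` that lie on a cycle of length at most `k + 1`. -/
def shortCyclePairs (G : SimpleGraph V) (k : ℕ) : Set (V × V) :=
  {p | G.Adj p.1 p.2 ∧ ∃ w : (G.deleteEdges {s(p.1, p.2)}).Walk p.1 p.2, w.length ≤ k}

theorem swap_mem_shortCyclePairs {k : ℕ} {a b : V} (h : (a, b) ∈ shortCyclePairs G k) :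
    (b, a) ∈ shortCyclePairs G k := by
  obtain ⟨h, w, hw⟩ := h
  have hedge : s(a, b) = s(b, a) := Sym2.eq_swap
  exact ⟨h.symm, (w.copy rfl rfl).reverse.mapLe (by rw [hedge]), by
    rwa [SimpleGraph.Walk.length_mapLe, SimpleGraph.Walk.length_reverse,
      SimpleGraph.Walk.length_copy]⟩

theorem not_isAcyclic_of_forall_adj [Finite V] {a b : V} (hab : G.Adj a b)
    (h : ∀ u v, G.Adj u v → ∃ w, w ≠ u ∧ G.Adj v w) : ¬ G.IsAcyclic := by
  classical
  intro hacyclic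
  have hpath (k : ℕ) : ∃ (v : V) (p : G.Walk a v), p.IsPath ∧ p.length = k + 1 := by
    induction k with
    | zero => exact ⟨b, hab.toWalk, hab.isPath_toWalk, rfl⟩
    | succ k ih =>
      obtain ⟨v, p, hp, hk⟩ := ih
      have hnil : ¬ p.Nil := by
        rw [← SimpleGraph.Walk.length_eq_zero_iff, hk]
        exact k.succ_ne_zero
      obtain ⟨w, hw, hvw⟩ := h _ _ (p.adj_penultimate hnil)
      have hsupport : w ∉ p.support := fun hmem =>
        hw (hacyclic.eq_penultimate_of_adj_end hp hvw hmem)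
      exact ⟨w, p.concat hvw, hp.concat hsupport hvw, by rw [p.length_concat, hk]⟩
  have := Fintype.ofFinite V
  obtain ⟨v, p, hp, hk⟩ := hpath (Fintype.card V)
  have hlt := hp.length_lt
  omega

theorem exists_mem_shortCyclePairs_of_le [Finite V] {H : SimpleGraph V} (hHG : H ≤ G)
    {a b : V} (hab : H.Adj a b) (h : ∀ u v, H.Adj u v → ∃ w, w ≠ u ∧ H.Adj v w) {k : ℕ}
    (hk : H.edgeSet.ncard ≤ k) : ∃ u v, H.Adj u v ∧ (u, v) ∈ shortCyclePairs G k := by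
  classical
  have hcyclic := not_isAcyclic_of_forall_adj hab h
  rw [SimpleGraph.isAcyclic_iff_forall_adj_isBridge] at hcyclic
  push Not at hcyclic
  obtain ⟨u, v, huv, hbridge⟩ := hcyclic
  rw [SimpleGraph.isBridge_iff, not_not] at hbridge
  obtain ⟨p, hp⟩ := hbridge.exists_isPath
  refine ⟨u, v, huv, hHG huv, p.mapLe (SimpleGraph.deleteEdges_mono hHG), ?_⟩
  have : Fintype (H.deleteEdges {s(u, v)}).edgeSet := Fintype.ofFinite _
  calc (p.mapLe (SimpleGraph.deleteEdges_mono hHG)).length = p.length := p.length_mapLe _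
    _ ≤ (H.deleteEdges {s(u, v)}).edgeFinset.card := hp.isTrail.length_le_card_edgeFinset
    _ = (H.deleteEdges {s(u, v)}).edgeSet.ncard := by
      rw [← Set.ncard_coe_finset, SimpleGraph.coe_edgeFinset]
    _ ≤ H.edgeSet.ncard :=
      Set.ncard_le_ncard (SimpleGraph.edgeSet_mono (SimpleGraph.deleteEdges_le _))
    _ ≤ k := hk

theorem exists_dart_mem_shortCyclePairs [Finite V] {O : Set G.Dart} (hO : O.Nonempty)
    (hnext : ∀ a ∈ O, ∃ b ∈ O, b.fst = a.snd ∧ b.snd ≠ a.fst)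
    (hprev : ∀ a ∈ O, ∃ b ∈ O, b.snd = a.fst ∧ b.fst ≠ a.snd) {k : ℕ} (hk : O.ncard ≤ k) :
    ∃ a ∈ O, a.toProd ∈ shortCyclePairs G k := by
  let H : SimpleGraph V := SimpleGraph.fromEdgeSet (SimpleGraph.Dart.edge '' O)
  have hHG : H ≤ G := by
    rw [SimpleGraph.fromEdgeSet_le]
    rintro _ ⟨⟨b, -, rfl⟩, -⟩
    exact b.edge_mem
  have hadj {b : G.Dart} (hb : b ∈ O) : H.Adj b.fst b.snd :=
    (SimpleGraph.fromEdgeSet_adj _).2 ⟨⟨b, hb, rfl⟩, b.adj.ne⟩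
  have hdart {u v : V} (huv : H.Adj u v) :
      ∃ b ∈ O, b.fst = u ∧ b.snd = v ∨ b.fst = v ∧ b.snd = u := by
    obtain ⟨⟨b, hb, hbuv⟩, -⟩ := (SimpleGraph.fromEdgeSet_adj _).1 huv
    exact ⟨b, hb, SimpleGraph.dart_edge_eq_mk'_iff'.1 hbuv⟩
  have hdegree (u v : V) (huv : H.Adj u v) : ∃ w, w ≠ u ∧ H.Adj v w := by
    obtain ⟨b, hb, ⟨rfl, rfl⟩ | ⟨rfl, rfl⟩⟩ := hdart huv
    · obtain ⟨c, hc, hfst, hne⟩ := hnext b hb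
      exact ⟨c.snd, hne, hfst ▸ hadj hc⟩
    · obtain ⟨c, hc, hsnd, hne⟩ := hprev b hb
      exact ⟨c.fst, hne, hsnd ▸ (hadj hc).symm⟩
  have hcard : H.edgeSet.ncard ≤ k := by
    refine le_trans ?_ ((Set.ncard_image_le (f := SimpleGraph.Dart.edge)).trans hk)
    exact Set.ncard_le_ncard (SimpleGraph.edgeSet_fromEdgeSet _ ▸ Set.sdiff_subset)
  obtain ⟨a, ha⟩ := hO
  obtain ⟨u, v, huv, hmem⟩ := exists_mem_shortCyclePairs_of_le hHG (hadj ha) hdegree hcard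
  obtain ⟨b, hb, ⟨rfl, rfl⟩ | ⟨rfl, rfl⟩⟩ := hdart huv
  · exact ⟨b, hb, hmem⟩
  · exact ⟨b, hb, swap_mem_shortCyclePairs hmem⟩

end ShortCycles

section FacesAreLong

theorem sum_ncard_inter_preimage {X Q : Type*} [Finite X] [Fintype Q] (f : X → Q) (B : Set X) :
    ∑ q, (B ∩ f ⁻¹' {q}).ncard = B.ncard := by
  classical
  have := Fintype.ofFinite X
  rw [Set.ncard_eq_toFinset_card',
    Finset.card_eq_sum_card_fiberwise (f := f) (t := Finset.univ) fun _ _ => Finset.mem_univ _]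
  refine Finset.sum_congr rfl fun q _ => ?_
  rw [← Set.ncard_coe_finset]
  congr 1
  ext x
  simp

theorem mul_card_le_card_add_mul_ncard {X Q : Type*} [Finite X] [Finite Q] {f : X → Q}
    {B : Set X} {L : ℕ} (h : ∀ q, (f ⁻¹' {q}).ncard < L → (B ∩ f ⁻¹' {q}).Nonempty) :
    L * Nat.card Q ≤ Nat.card X + L * B.ncard := by
  have := Fintype.ofFinite Q
  have hfibre (q : Q) : L ≤ (f ⁻¹' {q}).ncard + L * (B ∩ f ⁻¹' {q}).ncard := by
    rcases lt_or_ge (f ⁻¹' {q}).ncard L with hlt | hge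
    · exact le_add_left (Nat.le_mul_of_pos_right L ((Set.ncard_pos).2 (h q hlt)))
    · exact le_add_right hge
  calc L * Nat.card Q = ∑ _q : Q, L := by
        rw [Finset.sum_const, Finset.card_univ, Nat.card_eq_fintype_card, smul_eq_mul, mul_comm]
    _ ≤ ∑ q, ((f ⁻¹' {q}).ncard + L * (B ∩ f ⁻¹' {q}).ncard) :=
      Finset.sum_le_sum fun q _ => hfibre q
    _ = Nat.card X + L * B.ncard := by
      have huniv := sum_ncard_inter_preimage f Set.univ
      simp only [Set.univ_inter, Set.ncard_univ] at huniv
      rw [Finset.sum_add_distrib, ← Finset.mul_sum, sum_ncard_inter_preimage, huniv]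

theorem RotationSystem.mul_numFaces_le {V : Type*} [Finite V] {G : SimpleGraph V}
    (R : RotationSystem G) (hG : ∀ v, (G.neighborSet v).Nontrivial) {L k : ℕ} (hLk : L ≤ k) :
    L * R.numFaces ≤ Nat.card G.Dart + L * (shortCyclePairs G k).ncard := by
  let face : G.Dart → Quotient (SameCycle.setoid (R.rot * dartRev G)) := Quotient.mk _
  have hface (a : G.Dart) : face (R.rot a.symm) = face a :=
    Quotient.sound ((sameCycle_apply_left (f := R.rot * dartRev G)).2 (SameCycle.refl _ a))
  have hne (a : G.Dart) : (R.rot a).snd ≠ a.snd := fun h =>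
    R.rot_ne hG a (SimpleGraph.Dart.ext _ _ (Prod.ext (R.fst_rot a) h))
  have hnext (a : G.Dart) :
      ∃ b, face b = face a ∧ b.fst = a.snd ∧ b.snd ≠ a.fst :=
    ⟨R.rot a.symm, hface a, R.fst_rot a.symm, hne a.symm⟩
  have hprev (a : G.Dart) : ∃ b, face b = face a ∧ b.snd = a.fst ∧ b.fst ≠ a.snd := by
    obtain ⟨c, rfl⟩ := R.rot.surjective a
    exact ⟨c.symm, (hface c.symm).symm, (R.fst_rot c).symm, (hne c).symm⟩
  have hfibre (q) (hq : (face ⁻¹' {q}).ncard < L) :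
      ({a : G.Dart | a.toProd ∈ shortCyclePairs G k} ∩ face ⁻¹' {q}).Nonempty := by
    obtain ⟨a, ha, hshort⟩ := exists_dart_mem_shortCyclePairs (O := face ⁻¹' {q})
      (Quotient.mk_surjective q)
      (fun a ha => let ⟨b, hb, h⟩ := hnext a; ⟨b, hb.trans ha, h⟩)
      (fun a ha => let ⟨b, hb, h⟩ := hprev a; ⟨b, hb.trans ha, h⟩) (hq.le.trans hLk)
    exact ⟨a, hshort, ha⟩
  have hle : {a : G.Dart | a.toProd ∈ shortCyclePairs G k}.ncard ≤ (shortCyclePairs G k).ncard :=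
    Set.ncard_le_ncard_of_injOn _ (fun _ h => h) SimpleGraph.Dart.toProd_injective.injOn
  exact (mul_card_le_card_add_mul_ncard hfibre).trans
    (Nat.add_le_add_left (Nat.mul_le_mul_left L hle) _)

theorem abs_four_mul_genus_sub_le {V : Type} [Finite V] [Nonempty V] {G : SimpleGraph V}
    (hG : ∀ v, (G.neighborSet v).Nontrivial) {L k : ℕ} (hLk : L ≤ k) :
    L * |4 * (G.genus : ℤ) + 2 * Nat.card V - Nat.card G.Dart| ≤
      2 * (Nat.card G.Dart + L * (shortCyclePairs G k).ncard) := by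
  have hnonempty (v : V) := (hG v).nonempty
  obtain ⟨R, hlower⟩ := RotationSystem.exists_card_dart_le_genus hnonempty
  have hupper := R.four_mul_genus_add_le hnonempty
  have hfaces := R.mul_numFaces_le hG hLk
  have habs : |4 * (G.genus : ℤ) + 2 * Nat.card V - Nat.card G.Dart| ≤ 2 * R.numFaces := by
    rw [abs_le]
    constructor <;> omega
  calc (L : ℤ) * |4 * (G.genus : ℤ) + 2 * Nat.card V - Nat.card G.Dart|
      ≤ L * (2 * R.numFaces) := by gcongr
    _ = 2 * (L * R.numFaces) := by ring
    _ ≤ 2 * (Nat.card G.Dart + L * (shortCyclePairs G k).ncard) := by exact_mod_cast by omega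

end FacesAreLong

section EdgeSwitch

variable {V : Type*} {G : SimpleGraph V} {a b x y : V}

/-- The switching of `G` at `ab` and `xy`: the edges `ab`, `xy` are exchanged with the non-edges
`ax`, `by`. As a symmetric difference it is defined for all `a b x y` and is an involution. -/
def edgeSwitch (G : SimpleGraph V) (a b x y : V) : SimpleGraph V :=
  symmDiff G (SimpleGraph.fromEdgeSet {s(a, b), s(x, y), s(a, x), s(b, y)})

theorem edgeSwitch_edgeSwitch (G : SimpleGraph V) (a b x y : V) :
    edgeSwitch (edgeSwitch G a b x y) a b x y = G := by
  rw [edgeSwitch, edgeSwitch, symmDiff_assoc, symmDiff_self, symmDiff_bot]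

theorem edgeSwitch_adj {u v : V} : (edgeSwitch G a b x y).Adj u v ↔
    Xor (G.Adj u v)
      ((s(u, v) = s(a, b) ∨ s(u, v) = s(x, y) ∨ s(u, v) = s(a, x) ∨ s(u, v) = s(b, y)) ∧
        u ≠ v) := by
  simp only [edgeSwitch, symmDiff, SimpleGraph.sup_adj, SimpleGraph.sdiff_adj,
    SimpleGraph.fromEdgeSet_adj, Set.mem_insert_iff, Set.mem_singleton_iff, Xor]

theorem edgeSwitch_adj_fst (hax : ¬ G.Adj a x) (hne : a ≠ x) : (edgeSwitch G a b x y).Adj a x :=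
  edgeSwitch_adj.2 (Or.inr ⟨⟨Or.inr (Or.inr (Or.inl rfl)), hne⟩, hax⟩)

theorem edgeSwitch_adj_snd (hby : ¬ G.Adj b y) (hne : b ≠ y) : (edgeSwitch G a b x y).Adj b y :=
  edgeSwitch_adj.2 (Or.inr ⟨⟨Or.inr (Or.inr (Or.inr rfl)), hne⟩, hby⟩)

theorem edgeSwitch_adj_of_adj {u v : V} (hax : ¬ G.Adj a x) (hby : ¬ G.Adj b y)
    (huv : G.Adj u v) (hab : s(u, v) ≠ s(a, b)) (hxy : s(u, v) ≠ s(x, y)) :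
    (edgeSwitch G a b x y).Adj u v := by
  refine edgeSwitch_adj.2 (Or.inl ⟨huv, ?_⟩)
  rw [← SimpleGraph.mem_edgeSet] at hax hby huv
  rintro ⟨h | h | h | h, -⟩
  exacts [hab h, hxy h, hax (h ▸ huv), hby (h ▸ huv)]

theorem ncard_neighborSet_of_exchange [Finite V] {G' : SimpleGraph V} {u p q : V}
    (hp : G.Adj u p) (hq : ¬ G.Adj u q) (hp' : ¬ G'.Adj u p) (hq' : G'.Adj u q)
    (h : ∀ v, v ≠ p → v ≠ q → (G'.Adj u v ↔ G.Adj u v)) :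
    (G'.neighborSet u).ncard = (G.neighborSet u).ncard := by
  have hinsert : insert p (G'.neighborSet u) = insert q (G.neighborSet u) := by
    ext v
    simp only [Set.mem_insert_iff, SimpleGraph.mem_neighborSet]
    grind
  have hcard := congrArg Set.ncard hinsert
  rw [Set.ncard_insert_of_notMem (s := G'.neighborSet u) hp',
    Set.ncard_insert_of_notMem (s := G.neighborSet u) hq] at hcard
  exact Nat.add_right_cancel hcard

theorem ncard_neighborSet_edgeSwitch [Finite V] (hab : G.Adj a b) (hxy : G.Adj x y)
    (hax : ¬ G.Adj a x) (hby : ¬ G.Adj b y) (hxa : x ≠ a) (hxb : x ≠ b) (hya : y ≠ a)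
    (hyb : y ≠ b) (u : V) :
    ((edgeSwitch G a b x y).neighborSet u).ncard = (G.neighborSet u).ncard := by
  have hab_ne := hab.ne
  have hxy_ne := hxy.ne
  have hba := hab.symm
  have hyx := hxy.symm
  have hxa_adj : ¬ G.Adj x a := fun h => hax h.symm
  have hyb_adj : ¬ G.Adj y b := fun h => hby h.symm
  by_cases hu : u = a ∨ u = b ∨ u = x ∨ u = y
  · rcases hu with rfl | rfl | rfl | rfl
    on_goal 1 => refine ncard_neighborSet_of_exchange hab hax ?_ ?_ fun v hv hv' => ?_
    on_goal 4 => refine ncard_neighborSet_of_exchange hba hby ?_ ?_ fun v hv hv' => ?_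
    on_goal 7 => refine ncard_neighborSet_of_exchange hxy hxa_adj ?_ ?_ fun v hv hv' => ?_
    on_goal 10 => refine ncard_neighborSet_of_exchange hyx hyb_adj ?_ ?_ fun v hv hv' => ?_
    all_goals
      simp only [edgeSwitch_adj, Sym2.eq_iff, Xor]
      grind
  · congr 1
    ext v
    simp only [SimpleGraph.mem_neighborSet, edgeSwitch_adj, Sym2.eq_iff, Xor]
    grind

end EdgeSwitch

section RegularCounting

variable {V : Type*} [Fintype V] {G : SimpleGraph V} {d : ℕ}

open Classical in
theorem card_filter_adj (G : SimpleGraph V) (v : V) :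
    (Finset.univ.filter (G.Adj v)).card = (G.neighborSet v).ncard := by
  rw [← Set.ncard_coe_finset, Finset.coe_filter_univ]
  rfl

open Classical in
theorem card_filter_adj_and_fst_mem (hG : ∀ v, (G.neighborSet v).ncard = d) (S : Finset V) :
    (Finset.univ.filter fun q : V × V => G.Adj q.1 q.2 ∧ q.1 ∈ S).card = S.card * d := by
  rw [Finset.card_eq_sum_card_fiberwise (f := Prod.fst) (t := S) fun q hq => by simp_all]
  refine Finset.sum_const_nat fun x hx => ?_
  rw [← hG x, ← card_filter_adj]
  refine Finset.card_nbij' Prod.snd (Prod.mk x) ?_ ?_ ?_ ?_ <;> intro q hq <;> grind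

open Classical in
theorem card_filter_adj_and_fst_mem_insert_le (hG : ∀ v, (G.neighborSet v).ncard = d)
    (a b c : V) :
    (Finset.univ.filter fun q : V × V => G.Adj q.1 q.2 ∧
      q.1 ∈ insert a (insert b (Finset.univ.filter (G.Adj c)))).card ≤ (d + 2) * d := by
  rw [card_filter_adj_and_fst_mem hG]
  refine Nat.mul_le_mul_right d ?_
  rw [← hG c, ← card_filter_adj]
  exact (Finset.card_insert_le _ _).trans (Nat.succ_le_succ (Finset.card_insert_le _ _))

open Classical in
theorem card_ball_le (hG : ∀ v, (G.neighborSet v).ncard = d) (k : ℕ) (a : V) :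
    (Finset.univ.filter fun b => ∃ w : G.Walk a b, w.length ≤ k).card ≤ (d + 1) ^ k := by
  induction k generalizing a with
  | zero =>
    refine Finset.card_le_card (t := {a}) fun b hb => ?_
    obtain ⟨w, hw⟩ := (Finset.mem_filter.1 hb).2
    exact Finset.mem_singleton.2 (w.eq_of_length_eq_zero (Nat.le_zero.1 hw)).symm
  | succ k ih =>
    have hsub : (Finset.univ.filter fun b => ∃ w : G.Walk a b, w.length ≤ k + 1) ⊆
        (insert a (Finset.univ.filter (G.Adj a))).biUnion
          fun c => Finset.univ.filter fun b => ∃ w : G.Walk c b, w.length ≤ k := by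
      intro b hb
      simp only [Finset.mem_filter, Finset.mem_univ, true_and, Finset.mem_insert,
        Finset.mem_biUnion] at hb ⊢
      obtain ⟨w, hw⟩ := hb
      cases w with
      | nil => exact ⟨a, Or.inl rfl, SimpleGraph.Walk.nil, Nat.zero_le k⟩
      | cons h p => exact ⟨_, Or.inr h, p, Nat.le_of_succ_le_succ hw⟩
    have hcard : (insert a (Finset.univ.filter (G.Adj a))).card ≤ d + 1 := by
      rw [← hG a, ← card_filter_adj]
      exact Finset.card_insert_le _ _
    calc _ ≤ (insert a (Finset.univ.filter (G.Adj a))).card * (d + 1) ^ k :=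
          (Finset.card_le_card hsub).trans (Finset.card_biUnion_le_card_mul _ _ _ fun c _ => ih c)
      _ ≤ (d + 1) * (d + 1) ^ k := Nat.mul_le_mul_right _ hcard
      _ = (d + 1) ^ (k + 1) := (pow_succ' _ _).symm

open Classical in
theorem card_filter_mk_mem_edges_le {u v : V} (w : G.Walk u v) :
    (Finset.univ.filter fun q : V × V => s(q.1, q.2) ∈ w.edges).card ≤ 2 * w.length := by
  have hfiber : ∀ e ∈ w.edges.toFinset, ((Finset.univ.filter fun q : V × V =>
      s(q.1, q.2) ∈ w.edges).filter fun q => s(q.1, q.2) = e).card ≤ 2 := by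
    intro e _
    induction e with
    | _ x y =>
      refine (Finset.card_le_card (t := {(x, y), (y, x)}) fun q hq => ?_).trans Finset.card_le_two
      have hxy := Sym2.eq_iff.1 (Finset.mem_filter.1 hq).2
      simpa only [Finset.mem_insert, Finset.mem_singleton, Prod.ext_iff] using hxy
  calc _ ≤ 2 * w.edges.toFinset.card :=
        Finset.card_le_mul_card_image_of_maps_to (by simp) 2 hfiber
    _ ≤ 2 * w.length :=
        Nat.mul_le_mul_left 2 ((List.toFinset_card_le _).trans_eq w.length_edges)

end RegularCounting

section Switchable

variable {V : Type*} {G : SimpleGraph V} {d k : ℕ} {a b x y : V}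

/-- The oriented edges `xy` such that `edgeSwitch G a b x y` is a switching that preserves all
degrees and keeps some walk of length at most `k` from `a` to `b` that avoids `ab`. -/
def switchable (G : SimpleGraph V) (k : ℕ) (a b : V) : Set (V × V) :=
  {q | G.Adj q.1 q.2 ∧ q.1 ∉ insert a (insert b (G.neighborSet a)) ∧
    q.2 ∉ insert a (insert b (G.neighborSet b)) ∧
    ∃ w : (G.deleteEdges {s(a, b)}).Walk a b, w.length ≤ k ∧ s(q.1, q.2) ∉ w.edges}

theorem ncard_neighborSet_edgeSwitch_of_mem_switchable [Finite V] (hab : G.Adj a b)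
    (hxy : (x, y) ∈ switchable G k a b) (v : V) :
    ((edgeSwitch G a b x y).neighborSet v).ncard = (G.neighborSet v).ncard := by
  obtain ⟨hxy, hx, hy, -⟩ := hxy
  simp only [Set.mem_insert_iff, SimpleGraph.mem_neighborSet, not_or] at hx hy
  exact ncard_neighborSet_edgeSwitch hab hxy hx.2.2 hy.2.2 hx.1 hx.2.1 hy.1 hy.2.1 v

theorem edgeSwitch_adj_of_mem_switchable (hxy : (x, y) ∈ switchable G k a b) :
    (edgeSwitch G a b x y).Adj a x ∧ (edgeSwitch G a b x y).Adj b y := by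
  obtain ⟨-, hx, hy, -⟩ := hxy
  simp only [Set.mem_insert_iff, SimpleGraph.mem_neighborSet, not_or] at hx hy
  exact ⟨edgeSwitch_adj_fst hx.2.2 (Ne.symm hx.1), edgeSwitch_adj_snd hy.2.2 (Ne.symm hy.2.1)⟩

theorem exists_walk_edgeSwitch_of_mem_switchable (hxy : (x, y) ∈ switchable G k a b) :
    ∃ w : (edgeSwitch G a b x y).Walk a b, w.length ≤ k := by
  obtain ⟨-, hx, hy, w, hwk, hw⟩ := hxy
  simp only [Set.mem_insert_iff, SimpleGraph.mem_neighborSet, not_or] at hx hy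
  refine ⟨w.transfer _ fun e he => ?_, by rwa [SimpleGraph.Walk.length_transfer]⟩
  have hedge := w.edges_subset_edgeSet he
  induction e with
  | _ u v =>
    rw [SimpleGraph.mem_edgeSet, SimpleGraph.deleteEdges_adj, Set.mem_singleton_iff] at hedge
    exact edgeSwitch_adj_of_adj hx.2.2 hy.2.2 hedge.1 hedge.2 fun h => hw (h ▸ he)

theorem le_ncard_switchable_add [Finite V] (hG : ∀ v, (G.neighborSet v).ncard = d)
    (hab : (a, b) ∈ shortCyclePairs G k) :
    Nat.card V * d ≤ (switchable G k a b).ncard + (2 * ((d + 2) * d) + 2 * k) := by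
  classical
  have := Fintype.ofFinite V
  obtain ⟨-, w, hw⟩ := hab
  let N (c : V) : Finset V := insert a (insert b (Finset.univ.filter (G.Adj c)))
  let D (S : Finset V) : Finset (V × V) := Finset.univ.filter fun q => G.Adj q.1 q.2 ∧ q.1 ∈ S
  let W : Finset (V × V) := Finset.univ.filter fun q => s(q.1, q.2) ∈ w.edges
  have hsub : D Finset.univ ⊆
      (switchable G k a b).toFinset ∪ (D (N a) ∪ (D (N b)).image Prod.swap ∪ W) := by
    rintro ⟨u, v⟩ huv
    replace huv : G.Adj u v := (Finset.mem_filter.1 huv).2.1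
    by_cases hu : u ∈ N a
    · simp [D, huv, hu]
    by_cases hv : v ∈ N b
    · simp [D, huv.symm, hv]
    by_cases he : s(u, v) ∈ w.edges
    · simp [W, he]
    refine Finset.mem_union_left _ (Set.mem_toFinset.2 ⟨huv, ?_, ?_, w, hw, he⟩)
    · simpa [N] using hu
    · simpa [N] using hv
  calc Nat.card V * d = (D Finset.univ).card := by
        rw [card_filter_adj_and_fst_mem hG, Finset.card_univ, Nat.card_eq_fintype_card]
    _ ≤ (switchable G k a b).toFinset.card +
        ((D (N a)).card + ((D (N b)).image Prod.swap).card + W.card) :=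
      (Finset.card_le_card hsub).trans <| (Finset.card_union_le _ _).trans <|
        Nat.add_le_add_left ((Finset.card_union_le _ _).trans
          (Nat.add_le_add_right (Finset.card_union_le _ _) _)) _
    _ ≤ (switchable G k a b).ncard + ((d + 2) * d + (d + 2) * d + 2 * k) := by
      rw [Set.ncard_eq_toFinset_card']
      have hswap : ((D (N b)).image Prod.swap).card ≤ (D (N b)).card := Finset.card_image_le
      gcongr
      · exact card_filter_adj_and_fst_mem_insert_le hG a b a
      · exact hswap.trans (card_filter_adj_and_fst_mem_insert_le hG a b b)
      · exact (card_filter_mk_mem_edges_le w).trans (Nat.mul_le_mul_left 2 hw)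
    _ = _ := by ring

end Switchable

section DoubleCounting

variable {V : Type*} [Fintype V] {d k : ℕ} {R : Finset (SimpleGraph V)}

open Classical in
/-- The switchings `(G, ab, xy)` from graphs `G` in `R` that destroy a short cycle through `ab`. -/
noncomputable def forwardSwitchings (R : Finset (SimpleGraph V)) (k : ℕ) :
    Finset (Σ _ : SimpleGraph V, Σ _ : V × V, V × V) :=
  R.sigma fun G => (shortCyclePairs G k).toFinset.sigma fun p => (switchable G k p.1 p.2).toFinset

open Classical in
/-- The data `(G, ab, xy)` that a switching into `G` in `R` can have: `a` and `b` are close in `G`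
and `ax`, `by` are edges of `G`. -/
noncomputable def backwardSwitchings (R : Finset (SimpleGraph V)) (k : ℕ) :
    Finset (Σ _ : SimpleGraph V, Σ _ : V × V, V × V) :=
  R.sigma fun G =>
    (Finset.univ.filter fun p : V × V => ∃ w : G.Walk p.1 p.2, w.length ≤ k).sigma fun p =>
      Finset.univ.filter (G.Adj p.1) ×ˢ Finset.univ.filter (G.Adj p.2)

open Classical in
theorem card_forwardSwitchings_le_card_backwardSwitchings
    (hR : ∀ G, G ∈ R ↔ ∀ v, (G.neighborSet v).ncard = d) :
    (forwardSwitchings R k).card ≤ (backwardSwitchings R k).card := by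
  refine Finset.card_le_card_of_injOn
    (fun t => ⟨edgeSwitch t.1 t.2.1.1 t.2.1.2 t.2.2.1 t.2.2.2, t.2⟩) ?_ ?_
  · rintro ⟨G, ⟨a, b⟩, ⟨x, y⟩⟩ ht
    simp only [forwardSwitchings, Finset.mem_coe, Finset.mem_sigma, Set.mem_toFinset] at ht
    obtain ⟨hG, ⟨hab, -⟩, hxy⟩ := ht
    simp only [backwardSwitchings, Finset.mem_coe, Finset.mem_sigma, Finset.mem_product,
      Finset.mem_filter, Finset.mem_univ, true_and]
    refine ⟨(hR _).2 fun v => ?_, exists_walk_edgeSwitch_of_mem_switchable hxy,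
      edgeSwitch_adj_of_mem_switchable hxy⟩
    rw [ncard_neighborSet_edgeSwitch_of_mem_switchable hab hxy, (hR G).1 hG v]
  · rintro ⟨G, t⟩ - ⟨G', t'⟩ - h
    simp only [Sigma.mk.injEq, heq_eq_eq] at h
    obtain ⟨h, rfl⟩ := h
    rw [← edgeSwitch_edgeSwitch G, h, edgeSwitch_edgeSwitch]

open Classical in
theorem mul_sum_ncard_shortCyclePairs_le_card_forwardSwitchings {m : ℕ}
    (hm : m + (2 * ((d + 2) * d) + 2 * k) ≤ Nat.card V * d)
    (hR : ∀ G ∈ R, ∀ v, (G.neighborSet v).ncard = d) :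
    m * ∑ G ∈ R, (shortCyclePairs G k).ncard ≤ (forwardSwitchings R k).card := by
  rw [forwardSwitchings, Finset.card_sigma, Finset.mul_sum]
  refine Finset.sum_le_sum fun G hG => ?_
  rw [Finset.card_sigma, mul_comm, Set.ncard_eq_toFinset_card', ← smul_eq_mul]
  refine Finset.card_nsmul_le_sum _ _ _ fun p hp => ?_
  rw [← Set.ncard_eq_toFinset_card']
  have hlarge := le_ncard_switchable_add (hR G hG) (Set.mem_toFinset.1 hp)
  omega

open Classical in
theorem card_backwardSwitchings_le (hR : ∀ G ∈ R, ∀ v, (G.neighborSet v).ncard = d) :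
    (backwardSwitchings R k).card ≤ R.card * (Nat.card V * (d + 1) ^ k * (d * d)) := by
  rw [backwardSwitchings, Finset.card_sigma, ← smul_eq_mul R.card]
  refine Finset.sum_le_card_nsmul _ _ _ fun G hG => ?_
  rw [Finset.card_sigma]
  simp only [Finset.card_product, card_filter_adj, hR G hG, Finset.sum_const, smul_eq_mul]
  refine Nat.mul_le_mul_right _ ?_
  rw [Finset.card_filter, Fintype.sum_prod_type, Nat.card_eq_fintype_card]
  simp only [← Finset.card_filter]
  exact Finset.sum_le_card_nsmul _ _ _ fun a _ => card_ball_le (hR G hG) k a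

theorem mul_sum_ncard_shortCyclePairs_le {V : Type*} [Finite V] {R : Finset (SimpleGraph V)}
    {d k m : ℕ} (hm : m + (2 * ((d + 2) * d) + 2 * k) ≤ Nat.card V * d)
    (hR : ∀ G, G ∈ R ↔ ∀ v, (G.neighborSet v).ncard = d) :
    m * ∑ G ∈ R, (shortCyclePairs G k).ncard ≤
      R.card * (Nat.card V * (d + 1) ^ k * (d * d)) := by
  have := Fintype.ofFinite V
  calc m * ∑ G ∈ R, (shortCyclePairs G k).ncard
      ≤ (forwardSwitchings R k).card :=
        mul_sum_ncard_shortCyclePairs_le_card_forwardSwitchings hm fun G hG => (hR G).1 hG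
    _ ≤ (backwardSwitchings R k).card := card_forwardSwitchings_le_card_backwardSwitchings hR
    _ ≤ R.card * (Nat.card V * (d + 1) ^ k * (d * d)) :=
        card_backwardSwitchings_le fun G hG => (hR G).1 hG

end DoubleCounting

section RandomRegularGraphs

theorem mem_regularGraphs {n d : ℕ} {G : SimpleGraph (Fin n)} :
    G ∈ regularGraphs n d ↔ ∀ v, (G.neighborSet v).ncard = d := by
  classical
  refine forall_congr' fun v => ?_
  rw [← SimpleGraph.card_neighborSet_eq_degree, ← Nat.card_eq_fintype_card, Nat.card_coe_set_eq]

theorem exists_symmetric_finset {n d : ℕ} (hn : d < n) (he : Even (d * n)) :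
    ∃ P : Finset ℕ, P.card = d ∧ ∀ x ∈ P, 0 < x ∧ x < n ∧ n - x ∈ P := by
  obtain ⟨m, rfl | rfl⟩ := Nat.even_or_odd' d
  · refine ⟨Finset.Icc 1 m ∪ Finset.Ico (n - m) n, ?_, ?_⟩
    · rw [Finset.card_union_of_disjoint (Finset.disjoint_left.2 fun x => ?_), Nat.card_Icc,
        Nat.card_Ico]
      · omega
      · simp only [Finset.mem_Icc, Finset.mem_Ico]
        omega
    · simp only [Finset.mem_union, Finset.mem_Icc, Finset.mem_Ico]
      omega
  · obtain ⟨h, rfl⟩ : 2 ∣ n :=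
      ((Nat.even_mul.1 he).resolve_left (by simp)).two_dvd
    refine ⟨Finset.Ico (h - m) (h + m + 1), by rw [Nat.card_Ico]; omega, ?_⟩
    simp only [Finset.mem_Ico]
    omega

theorem regularGraphs_nonempty {n d : ℕ} (hn : d < n) (he : Even (d * n)) :
    (regularGraphs n d).Nonempty := by
  obtain ⟨P, hcard, hP⟩ := exists_symmetric_finset hn he
  have : NeZero n := ⟨by omega⟩
  have hneg : ∀ x : Fin n, x.val ∈ P → (-x).val ∈ P := by
    intro x hx
    obtain ⟨hpos, -, hsymm⟩ := hP _ hx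
    rwa [Fin.val_neg, if_neg (fun h => by simp [h] at hpos)]
  let circulant : SimpleGraph (Fin n) :=
    { Adj := fun u v => (v - u).val ∈ P
      symm := ⟨fun u v h => by rw [← neg_sub]; exact hneg _ h⟩
      loopless := ⟨fun u h => by
        rw [sub_self] at h
        exact absurd (hP _ h).1 (by simp)⟩ }
  refine ⟨circulant, mem_regularGraphs.2 fun u => ?_⟩
  rw [← hcard, ← Set.ncard_coe_finset]
  refine Set.ncard_congr (fun v _ => (v - u).val) (fun v hv => hv)
    (fun v w _ _ h => sub_left_injective (Fin.val_injective h)) fun x hx => ?_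
  refine ⟨u + ⟨x, (hP x hx).2.1⟩, ?_, by simp⟩
  change ((u + ⟨x, (hP x hx).2.1⟩ : Fin n) - u).val ∈ P
  simpa using hx

theorem regularGraphProb_le_one (n d : ℕ) (P : SimpleGraph (Fin n) → Prop) :
    regularGraphProb n d P ≤ 1 := by
  refine div_le_one_of_le₀ ?_ (Nat.cast_nonneg _)
  exact_mod_cast Set.ncard_le_ncard (Set.sep_subset (regularGraphs n d) P) (Set.toFinite _)

theorem one_sub_div_le_regularGraphProb {n d : ℕ} (hne : (regularGraphs n d).Nonempty)
    {P : SimpleGraph (Fin n) → Prop} {f : SimpleGraph (Fin n) → ℕ} {c t : ℝ} (ht : 0 < t)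
    (hf : ∑ G ∈ (regularGraphs n d).toFinite.toFinset, (f G : ℝ) ≤ (regularGraphs n d).ncard * c)
    (hP : ∀ G ∈ regularGraphs n d, f G ≤ t → P G) :
    1 - c / t ≤ regularGraphProb n d P := by
  classical
  set R := (regularGraphs n d).toFinite.toFinset with hR
  have hRcard : (regularGraphs n d).ncard = R.card := Set.ncard_eq_toFinset_card _
  have hgood : {G ∈ regularGraphs n d | P G}.ncard = (R.filter P).card := by
    rw [← Set.ncard_coe_finset, Finset.coe_filter]
    simp only [hR, Set.Finite.mem_toFinset]
  have hRpos : (0 : ℝ) < R.card := by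
    exact_mod_cast Finset.card_pos.2 ((Set.toFinite _).toFinset_nonempty.2 hne)
  have hsplit : ((R.filter P).card : ℝ) + (R.filter fun G => ¬ P G).card = R.card := by
    exact_mod_cast R.card_filter_add_card_filter_not P
  have hbad : ((R.filter fun G => ¬ P G).card : ℝ) * t ≤ R.card * c :=
    calc ((R.filter fun G => ¬ P G).card : ℝ) * t
        ≤ ∑ G ∈ R.filter fun G => ¬ P G, (f G : ℝ) := by
          rw [← nsmul_eq_mul]
          refine Finset.card_nsmul_le_sum _ _ _ fun G hG => ?_
          obtain ⟨hGR, hGP⟩ := Finset.mem_filter.1 hG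
          exact (not_le.1 (mt (hP G ((Set.toFinite _).mem_toFinset.1 hGR)) hGP)).le
      _ ≤ ∑ G ∈ R, (f G : ℝ) :=
          Finset.sum_le_sum_of_subset_of_nonneg (R.filter_subset _) fun _ _ _ => Nat.cast_nonneg _
      _ ≤ R.card * c := by rwa [← hRcard]
  rw [regularGraphProb, hRcard, hgood, le_div_iff₀ hRpos, sub_mul, one_mul, div_mul_eq_mul_div,
    sub_le_comm, ← hsplit, add_sub_cancel_left, hsplit, le_div_iff₀ ht, mul_comm c]
  exact hbad

theorem sum_ncard_shortCyclePairs_le {V : Type*} [Finite V] {R : Finset (SimpleGraph V)}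
    {d k : ℕ} (hd : 0 < d) (hV : 4 * ((d + 2) * d) + 4 * k < Nat.card V)
    (hR : ∀ G, G ∈ R ↔ ∀ v, (G.neighborSet v).ncard = d) :
    ∑ G ∈ R, (shortCyclePairs G k).ncard ≤ R.card * (2 * (d + 1) ^ k * d) := by
  set n := Nat.card V
  have hnd : n ≤ n * d := Nat.le_mul_of_pos_right n hd
  obtain ⟨m, hm⟩ : ∃ m, m + (2 * ((d + 2) * d) + 2 * k) = n * d :=
    ⟨_, Nat.sub_add_cancel (by omega)⟩
  refine Nat.le_of_mul_le_mul_left ?_ (show 0 < n * d by omega)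
  calc n * d * ∑ G ∈ R, (shortCyclePairs G k).ncard
      ≤ 2 * m * ∑ G ∈ R, (shortCyclePairs G k).ncard := Nat.mul_le_mul_right _ (by omega)
    _ = 2 * (m * ∑ G ∈ R, (shortCyclePairs G k).ncard) := mul_assoc _ _ _
    _ ≤ 2 * (R.card * (n * (d + 1) ^ k * (d * d))) :=
        Nat.mul_le_mul_left 2 (mul_sum_ncard_shortCyclePairs_le hm.le hR)
    _ = n * d * (R.card * (2 * (d + 1) ^ k * d)) := by ring

theorem tendsto_regularGraphProb_of_ncard_shortCyclePairs_le {d : ℕ} (hd : 0 < d) (k : ℕ) {δ : ℝ}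
    (hδ : 0 < δ) {P : ∀ n, SimpleGraph (Fin n) → Prop}
    (hP : ∀ᶠ n : ℕ in atTop, ∀ G ∈ regularGraphs n d,
      (shortCyclePairs G k).ncard ≤ δ * n → P n G) :
    Tendsto (fun n => regularGraphProb n d (P n)) (atTop ⊓ 𝓟 {n : ℕ | Even (d * n)}) (𝓝 1) := by
  have hlim : Tendsto (fun n : ℕ => 1 - 2 * ((d : ℝ) + 1) ^ k * d / (δ * n)) atTop (𝓝 1) := by
    simpa only [div_div, sub_zero] using
      (tendsto_const_div_atTop_nhds_zero_nat (2 * ((d : ℝ) + 1) ^ k * d / δ)).const_sub 1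
  refine tendsto_of_tendsto_of_tendsto_of_le_of_le' (hlim.mono_left inf_le_left)
    tendsto_const_nhds ?_ (Eventually.of_forall fun n => regularGraphProb_le_one n d _)
  rw [eventually_inf_principal]
  filter_upwards [hP, eventually_gt_atTop d, eventually_gt_atTop (4 * ((d + 2) * d) + 4 * k)]
    with n hPn hdn hn heven
  have hn_pos : (0 : ℝ) < n := by exact_mod_cast (Nat.zero_le d).trans_lt hdn
  refine one_sub_div_le_regularGraphProb (regularGraphs_nonempty hdn heven)
    (mul_pos hδ hn_pos) ?_ hPn
  rw [Set.ncard_eq_toFinset_card]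
  exact_mod_cast sum_ncard_shortCyclePairs_le hd (hn.trans_eq (Nat.card_fin n).symm) fun G => by
    rw [Set.Finite.mem_toFinset, mem_regularGraphs]

end RandomRegularGraphs

theorem abs_four_mul_genus_sub_le_of_ncard_shortCyclePairs_le {V : Type} [Finite V] [Nonempty V]
    {G : SimpleGraph V} {d : ℕ} (hd : 3 ≤ d) (hG : ∀ v, (G.neighborSet v).ncard = d) {ε : ℝ}
    (hε : 0 < ε) {L : ℕ} (hL : 4 * (d : ℝ) / ε ≤ L)
    (hshort : (shortCyclePairs G L).ncard ≤ ε / 4 * Nat.card V) :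
    |4 * (G.genus : ℝ) - (d - 2) * Nat.card V| ≤ ε * ((d - 2) * Nat.card V) := by
  have hnontrivial (v : V) : (G.neighborSet v).Nontrivial := by
    rw [← Set.one_lt_ncard_iff_nontrivial, hG v]
    omega
  have hd_le : (3 : ℝ) ≤ d := by exact_mod_cast hd
  have hL_pos : (0 : ℝ) < L := (by positivity : 0 < 4 * (d : ℝ) / ε).trans_le hL
  have hdL : (d : ℝ) * Nat.card V ≤ ε * L / 4 * Nat.card V := by
    rw [div_le_iff₀' hε] at hL
    gcongr
    linarith
  have hgenus := abs_four_mul_genus_sub_le hnontrivial (le_refl L)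
  rw [card_dart_of_ncard_neighborSet_eq hG] at hgenus
  refine le_of_mul_le_mul_left ?_ hL_pos
  calc L * |4 * (G.genus : ℝ) - (d - 2) * Nat.card V|
      = L * |4 * (G.genus : ℝ) + 2 * Nat.card V - Nat.card V * d| := by ring_nf
    _ ≤ 2 * (Nat.card V * d + L * (shortCyclePairs G L).ncard) := by exact_mod_cast hgenus
    _ ≤ 2 * (ε * L / 4 * Nat.card V + L * (ε / 4 * Nat.card V)) := by
      rw [mul_comm (Nat.card V : ℝ)]
      gcongr
    _ = L * (ε * (1 * Nat.card V)) := by ring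
    _ ≤ L * (ε * ((d - 2) * Nat.card V)) := by
      gcongr
      linarith

theorem theorem2 (d : ℕ) (hd : 2 ≤ d) (ε : ℝ) (hε : 0 < ε) :
    Tendsto
      (fun n : ℕ => regularGraphProb n d (fun G =>
        (1 - ε) * (((d : ℝ) - 2) * (n : ℝ) / 4) ≤ (G.genus : ℝ) ∧
        (G.genus : ℝ) ≤ (1 + ε) * (((d : ℝ) - 2) * (n : ℝ) / 4)))
      (atTop ⊓ 𝓟 {n : ℕ | Even (d * n)}) (𝓝 1) := by
  have hnonempty : ∀ᶠ n : ℕ in atTop, Nonempty (Fin n) :=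
    (eventually_gt_atTop 0).mono fun n hn => ⟨⟨0, hn⟩⟩
  rcases hd.eq_or_lt with rfl | hd3
  · refine tendsto_regularGraphProb_of_ncard_shortCyclePairs_le two_pos 0 one_pos ?_
    filter_upwards [hnonempty] with n _ G hG _
    simp [genus_eq_zero_of_ncard_neighborSet_eq_two (mem_regularGraphs.1 hG)]
  · obtain ⟨L, hL⟩ := exists_nat_ge (4 * (d : ℝ) / ε)
    refine tendsto_regularGraphProb_of_ncard_shortCyclePairs_le (by omega) L
      (by positivity : 0 < ε / 4) ?_
    filter_upwards [hnonempty] with n _ G hG hshort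
    have hgenus := abs_le.1 <| abs_four_mul_genus_sub_le_of_ncard_shortCyclePairs_le hd3
      (mem_regularGraphs.1 hG) hε hL (by rwa [Nat.card_fin])
    rw [Nat.card_fin] at hgenus
    constructor <;> linarith
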